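/- **Setting.** Let $\Sigma$ be the infinite honeycomb lattice in brick-wall form: vertex set $V=\mathbb Z^2\subset\mathbb R^2$, all horizontal unit edges, and vertical edges $(x,y)-(x,y+1)$ with $x+y$ odd. Its faces (each with six vertices) are properly colored red, green, blue ($\mathtt r,\mathtt g,\mathtt b$); an edge has color $c$ if it connects two faces of color $c$. A qubit sits at each vertex; $\mathcal A(\Lambda)$ is the norm closure of the algebra of local observables supported in $\Lambda\subseteq V$, and $\mathcal A=\mathcal A(V)$ is the quasi-local $C^*$-algebra. For a face $f$ put $K_f=\bigotimes_{v\in\partial f}\sigma^{\mathtt x}_v$ and $J_f=\bigotimes_{v\in\partial f}\sigma^{\mathtt z}_v$. For $A$ localized in a finite set $\Lambda$ let $\delta(A)=i[H,A]$ with $H=-\sum_{f:\,\partial f\cap\Lambda\ne\emptyset}(K_f+J_f)$. A state $\omega$ on $\mathcal A$ is a ground state if $-i\,\omega(A^*\delta(A))\ge 0$ for all local $A$. A half-infinite string $\gamma$ of color $c$ is a sequence $(f_0,v_0,v_1,f_1,v_2,v_3,f_2,\dots)$ without repeated vertices, in which all faces $f_i$ have color $c$, $f_i\neq f_{i+1}$,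 $v_{2i}\in\partial f_i$, $v_{2i+1}\in\partial f_{i+1}$, and $v_{2i},v_{2i+1}$ are joined by an edge. Let $\gamma_n$ be its initial segments, $S^{c\mathtt x}_{\gamma_n}=\bigotimes_{v_j\in\gamma_n}\sigma^{\mathtt x}_{v_j}$, $S^{c\mathtt z}_{\gamma_n}=\bigotimes_{v_j\in\gamma_n}\sigma^{\mathtt z}_{v_j}$, $S^{c\mathtt y}_{\gamma_n}=S^{c\mathtt x}_{\gamma_n}S^{c\mathtt z}_{\gamma_n}$, and for $k\in\{\mathtt x,\mathtt y,\mathtt z\}$ let $\rho^{ck}_\gamma(A)=\lim_{n}(S^{ck}_{\gamma_n})^*AS^{ck}_{\gamma_n}$ for $A\in\mathcal A$. A cone is the set of vertices in $\{x\in\mathbb R^2:(x-p)\cdot a>\|x-p\|\cos\theta\}$ with $p\in\mathbb R^2$, $\|a\|=1$, $0<\theta<\pi$. **Theorem.** There is a unique ground state $\omega_0$ of the color code on $\Sigma$ that is invariant under all translations mapping $\Sigma$ to itself; let $\pi_0$ be its GNS representation. Denote by $\pi^{ck}$ the GNS representation of $\omega_0\circ\rho^{ck}_{\gamma}$, and by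 $\pi^{ck,c'k'}$ the GNS representation of $\omega_0\circ\rho^{ck}_{\gamma}\circ\rho^{c'k'}_{\gamma'}$, where $\gamma$ and $\gamma'$ are half-infinite strings of colors $c$ and $c'$; all statements below hold for arbitrary choices of the strings, and $\simeq$ is unitary equivalence. 1. For all colors $c\neq c'$ and labels $k\neq k'$, the representation $\pi^{ck,c'k'}$ is a superselection sector, i.e. $\pi^{ck,c'k'}|_{\mathcal A(\Lambda^c)}\simeq\pi_0|_{\mathcal A(\Lambda^c)}$ for every cone $\Lambda$ with complement $\Lambda^c=V\setminus\Lambda$; it is not equivalent to $\pi_0$, nor to any $\pi^{c''k''}$ with $c''\in\{\mathtt r,\mathtt g,\mathtt b\}$, $k''\in\{\mathtt x,\mathtt y,\mathtt z\}$. 2. The following equivalences hold, defining the six sectors $\pi^{\mathtt f_1},\dots,\pi^{\mathtt f_6}$: $$\begin{aligned} \pi^{\mathtt f_1}:&\quad \pi^{\mathtt{rx},\mathtt{bz}}\simeq\pi^{\mathtt{ry},\mathtt{gz}}\simeq\pi^{\mathtt{gx},\mathtt{by}},& \pi^{\mathtt f_2}:&\quad \pi^{\mathtt{rz},\mathtt{bx}}\simeq\pi^{\mathtt{ry},\mathtt{gx}}\simeq\pi^{\mathtt{gz},\mathtt{by}},\\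 \pi^{\mathtt f_3}:&\quad \pi^{\mathtt{bz},\mathtt{gy}}\simeq\pi^{\mathtt{gx},\mathtt{rz}}\simeq\pi^{\mathtt{bx},\mathtt{ry}},& \pi^{\mathtt f_4}:&\quad \pi^{\mathtt{rz},\mathtt{gy}}\simeq\pi^{\mathtt{gx},\mathtt{bz}}\simeq\pi^{\mathtt{rx},\mathtt{by}},\\ \pi^{\mathtt f_5}:&\quad \pi^{\mathtt{rx},\mathtt{gy}}\simeq\pi^{\mathtt{bx},\mathtt{gz}}\simeq\pi^{\mathtt{by},\mathtt{rz}},& \pi^{\mathtt f_6}:&\quad \pi^{\mathtt{bx},\mathtt{gy}}\simeq\pi^{\mathtt{rx},\mathtt{gz}}\simeq\pi^{\mathtt{ry},\mathtt{bz}}. \end{aligned}$$ 3. Representations belonging to different $\mathtt f_i$ are not equivalent. -/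

import Mathlib

open scoped ComplexOrder ComplexConjugate

noncomputable section

namespace ColorCode

/-! ### The lattice

The trivalent lattice `Σ` is drawn with rectangular faces (the brick-wall form of the honeycomb
lattice): its vertices are the points of `ℤ × ℤ`, all horizontal unit edges are present, and the
vertical edge from `(x, y)` to `(x, y + 1)` is present exactly when `x + y` is odd. -/

abbrev Vertex : Type := ℤ × ℤ

/-- The lattice `Σ` as a graph. -/
def lattice : SimpleGraph Vertex :=
  SimpleGraph.fromRel fun v w =>
    w = (v.1 + 1, v.2) ∨ (Odd (v.1 + v.2) ∧ w = (v.1, v.2 + 1))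

/-- A face (brick) is given by its lower left corner, a point `(x, y)` with `x + y` odd. -/
abbrev Face : Type := {p : ℤ × ℤ // Odd (p.1 + p.2)}

/-- The six vertices of a brick, relative to its lower left corner. -/
def brick : List (ℤ × ℤ) := [(0, 0), (1, 0), (2, 0), (0, 1), (1, 1), (2, 1)]

/-- The six vertices `v ∈ ∂f` of a face. -/
def Face.boundary (f : Face) : List Vertex := brick.map fun d => f.1 + d

/-- The three colors: red, green, blue. -/
inductive Color
  | r | g | b
  deriving DecidableEq

/-- The three kinds of Pauli operators. -/
inductive Pauli
  | x | y | z
  deriving DecidableEq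

/-- The face coloring (unique up to a permutation of the colors). -/
def Face.color (f : Face) : Color :=
  if f.1.1 % 3 = 0 then .r else if f.1.1 % 3 = 1 then .g else .b

/-- The faces having at least one vertex in the finite set `Λ`. -/
def facesMeeting (Λ : Finset Vertex) : Finset Face :=
  (Λ.biUnion fun v => (brick.map fun d => v - d).toFinset).subtype fun p => Odd (p.1 + p.2)

theorem mem_facesMeeting {Λ : Finset Vertex} {f : Face} :
    f ∈ facesMeeting Λ ↔ ∃ v ∈ f.boundary, v ∈ Λ := by
  simp only [facesMeeting, Face.boundary, Finset.mem_subtype, Finset.mem_biUnion,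
    List.mem_toFinset, List.mem_map]
  constructor
  · rintro ⟨v, hv, d, hd, h⟩
    exact ⟨v, ⟨d, hd, by rw [← h]; abel⟩, hv⟩
  · rintro ⟨v, ⟨d, hd, h⟩, hv⟩
    exact ⟨v, hv, d, hd, by rw [← h]; abel⟩

/-! ### The quasi-local algebra

The algebra of local observables is represented faithfully on the Hilbert space with orthonormal
basis `|s⟩`, `s` a finite set of vertices: `|s⟩` is the product vector with the qubits at the
vertices of `s` in the state `|1⟩` and all other qubits in the state `|0⟩`.  The algebra
`A(Λ) = ⨂_{v ∈ Λ} M₂(ℂ)` of a finite set `Λ` acts on the tensor factors of the vertices in `Λ`.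
The quasi-local algebra is the norm closure of the union of these algebras. -/

abbrev ConfigSpace : Type := lp (fun _ : Finset Vertex => ℂ) 2

/-- The bounded operator `(T ψ)(s) = g s * ψ (σ s)`, for a permutation `σ` of the configurations
and a bounded weight `g`. -/
def weightedPerm (σ : Equiv.Perm (Finset Vertex)) (g : Finset Vertex → ℂ)
    (hg : ∃ C : ℝ, ∀ s, ‖g s‖ ≤ C) : ConfigSpace →L[ℂ] ConfigSpace :=
  have key : ∀ (C : ℝ), (∀ s, ‖g s‖ ≤ C) → ∀ (ψ : ConfigSpace) (F : Finset (Finset Vertex)),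
      ∑ s ∈ F, ‖g s * ψ (σ s)‖ ^ (2 : ENNReal).toReal ≤
        (C * ‖ψ‖) ^ (2 : ENNReal).toReal := by
    intro C hC ψ F
    have hC0 : 0 ≤ C := (norm_nonneg _).trans (hC ∅)
    have h2 : (0 : ℝ) < (2 : ENNReal).toReal := by norm_num
    calc ∑ s ∈ F, ‖g s * ψ (σ s)‖ ^ (2 : ENNReal).toReal
        ≤ ∑ s ∈ F, C ^ (2 : ENNReal).toReal * ‖ψ (σ s)‖ ^ (2 : ENNReal).toReal := by
          refine Finset.sum_le_sum fun s _ => ?_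
          rw [← Real.mul_rpow hC0 (norm_nonneg _), norm_mul]
          have := hC s
          gcongr
      _ = C ^ (2 : ENNReal).toReal *
            ∑ t ∈ F.map σ.toEmbedding, ‖ψ t‖ ^ (2 : ENNReal).toReal := by
          rw [Finset.sum_map, Finset.mul_sum]; rfl
      _ ≤ C ^ (2 : ENNReal).toReal * ‖ψ‖ ^ (2 : ENNReal).toReal := by
          gcongr
          exact lp.sum_rpow_le_norm_rpow h2 ψ _
      _ = (C * ‖ψ‖) ^ (2 : ENNReal).toReal := (Real.mul_rpow hC0 (norm_nonneg _)).symm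
  LinearMap.mkContinuous
    { toFun := fun ψ =>
        ⟨fun s => g s * ψ (σ s), memℓp_gen' (key hg.choose hg.choose_spec ψ)⟩
      map_add' := fun ψ φ => by
        ext s; exact mul_add _ _ _
      map_smul' := fun c ψ => by
        ext s; simp [mul_left_comm] }
    hg.choose
    (fun ψ => lp.norm_le_of_forall_sum_le (by norm_num)
      (mul_nonneg ((norm_nonneg _).trans (hg.choose_spec ∅)) (norm_nonneg _))
      (key hg.choose hg.choose_spec ψ))

@[simp] theorem weightedPerm_apply (σ g hg) (ψ : ConfigSpace) (s : Finset Vertex) :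
    weightedPerm σ g hg ψ s = g s * ψ (σ s) := rfl

theorem weightedPerm_adjoint (σ g hg hg') :
    star (weightedPerm σ g hg) =
      weightedPerm σ⁻¹ (fun s => conj (g (σ⁻¹ s))) hg' := by
  rw [ContinuousLinearMap.star_eq_adjoint]
  refine ((ContinuousLinearMap.eq_adjoint_iff _ _).2 fun x y => ?_).symm
  rw [lp.inner_eq_tsum, lp.inner_eq_tsum, ← Equiv.tsum_eq σ]
  refine tsum_congr fun s => ?_
  simp [mul_comm, mul_left_comm, mul_assoc]

/-- The state of the qubit at `v` in the configuration `s`. -/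
def spin (v : Vertex) (s : Finset Vertex) : Fin 2 := if v ∈ s then 1 else 0

/-- Flipping the qubit at `v`. -/
def flip (v : Vertex) : Equiv.Perm (Finset Vertex) :=
  Function.Involutive.toPerm (fun s => symmDiff s {v}) fun s => by simp

theorem flip_apply (v : Vertex) (s : Finset Vertex) : flip v s = symmDiff s {v} := rfl

theorem exists_bound_entry (M : Matrix (Fin 2) (Fin 2) ℂ) (i j : Finset Vertex → Fin 2) :
    ∃ C : ℝ, ∀ s, ‖M (i s) (j s)‖ ≤ C := by
  refine ⟨∑ a, ∑ b, ‖M a b‖, fun s => ?_⟩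
  refine le_trans ?_ (Finset.single_le_sum (f := fun a => ∑ b, ‖M a b‖)
    (fun a _ => Finset.sum_nonneg fun b _ => norm_nonneg _) (Finset.mem_univ (i s)))
  exact Finset.single_le_sum (f := fun b => ‖M (i s) b‖)
    (fun b _ => norm_nonneg _) (Finset.mem_univ (j s))

/-- The matrix `M` acting on the qubit at the vertex `v`. -/
def siteOp (v : Vertex) (M : Matrix (Fin 2) (Fin 2) ℂ) : ConfigSpace →L[ℂ] ConfigSpace :=
  weightedPerm 1 (fun s => M (spin v s) (spin v s)) (exists_bound_entry M _ _) +
  weightedPerm (flip v) (fun s => M (spin v s) (1 - spin v s)) (exists_bound_entry M _ _)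

theorem siteOp_apply (v : Vertex) (M : Matrix (Fin 2) (Fin 2) ℂ) (ψ : ConfigSpace)
    (s : Finset Vertex) :
    siteOp v M ψ s = M (spin v s) (spin v s) * ψ s + M (spin v s) (1 - spin v s) * ψ (flip v s) :=
  rfl

theorem spin_flip (v : Vertex) (s : Finset Vertex) : spin v (flip v s) = 1 - spin v s := by
  by_cases h : v ∈ s <;> simp [spin, flip_apply, Finset.mem_symmDiff, h]

theorem spin_flip_of_ne {v w : Vertex} (h : v ≠ w) (s : Finset Vertex) :
    spin v (flip w s) = spin v s := by
  simp [spin, flip_apply, Finset.mem_symmDiff, h]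

theorem flip_flip (v : Vertex) (s : Finset Vertex) : flip v (flip v s) = s := by
  simp [flip_apply]

theorem flip_comm (v w : Vertex) (s : Finset Vertex) :
    flip v (flip w s) = flip w (flip v s) := by
  simp only [flip_apply]
  exact symmDiff_right_comm _ _ _

theorem flip_symm (v : Vertex) : (flip v)⁻¹ = flip v := by
  rw [inv_eq_iff_mul_eq_one]
  ext1 s
  exact flip_flip v s

theorem siteOp_mul (v : Vertex) (M N : Matrix (Fin 2) (Fin 2) ℂ) :
    siteOp v (M * N) = siteOp v M * siteOp v N := by
  ext ψ s
  simp only [mul_apply_eq_comp, siteOp_apply, spin_flip, flip_flip, Matrix.mul_apply,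
    Fin.sum_univ_two]
  rcases Fin.exists_fin_two.1 ⟨spin v s, rfl⟩ with h | h <;> rw [h] <;> simp <;> ring

theorem siteOp_one (v : Vertex) : siteOp v 1 = 1 := by
  ext ψ s
  rw [siteOp_apply]
  rcases Fin.exists_fin_two.1 ⟨spin v s, rfl⟩ with h | h <;> rw [h] <;> simp

theorem siteOp_star (v : Vertex) (M : Matrix (Fin 2) (Fin 2) ℂ) :
    siteOp v (star M) = star (siteOp v M) := by
  rw [siteOp, siteOp, star_add,
    weightedPerm_adjoint 1 _ _ (exists_bound_entry (star M) _ _),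
    weightedPerm_adjoint (flip v) _ _ (by
      rw [flip_symm]; simp only [spin_flip, RCLike.norm_conj]
      exact exists_bound_entry M _ _)]
  ext ψ s
  simp only [flip_symm, spin_flip]
  rcases Fin.exists_fin_two.1 ⟨spin v s, rfl⟩ with h | h <;>
    simp [h, Matrix.star_apply]

theorem siteOp_comm {v w : Vertex} (h : v ≠ w) (M N : Matrix (Fin 2) (Fin 2) ℂ) :
    siteOp v M * siteOp w N = siteOp w N * siteOp v M := by
  ext ψ s
  simp only [mul_apply_eq_comp, siteOp_apply, spin_flip_of_ne h,
    spin_flip_of_ne h.symm, flip_comm v w]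
  ring

/-- The norm closed `*`-algebra generated by all one-qubit observables. -/
def quasiLocal : StarSubalgebra ℂ (ConfigSpace →L[ℂ] ConfigSpace) :=
  (StarAlgebra.adjoin ℂ {a | ∃ v M, siteOp v M = a}).topologicalClosure

instance : IsClosed (quasiLocal : Set (ConfigSpace →L[ℂ] ConfigSpace)) :=
  StarSubalgebra.isClosed_topologicalClosure _

/-- The quasi-local algebra `𝒜`. -/
def Obs : Type := quasiLocal

instance : CStarAlgebra Obs := inferInstanceAs (CStarAlgebra quasiLocal)
instance : PartialOrder Obs := CStarAlgebra.spectralOrder Obs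
instance : StarOrderedRing Obs := CStarAlgebra.spectralOrderedRing Obs

/-- The matrix `M` acting on the qubit at `v`, as an element of `𝒜`. -/
def site (v : Vertex) (M : Matrix (Fin 2) (Fin 2) ℂ) : Obs :=
  ⟨siteOp v M, StarSubalgebra.le_topologicalClosure _
    (StarAlgebra.subset_adjoin ℂ _ ⟨v, M, rfl⟩)⟩

/-- The algebra `A(Λ)` of observables localized in the set of vertices `Λ`. -/
def localAlg (Λ : Set Vertex) : StarSubalgebra ℂ Obs :=
  (StarAlgebra.adjoin ℂ {a | ∃ v ∈ Λ, ∃ M, site v M = a}).topologicalClosure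

/-- The inclusion of `𝒜` into the bounded operators. -/
def Obs.toOp : Obs →⋆ₐ[ℂ] (ConfigSpace →L[ℂ] ConfigSpace) := quasiLocal.subtype

theorem localAlg_univ : localAlg Set.univ = ⊤ := by
  refine top_unique fun x _ => ?_
  have hx : Obs.toOp x ∈ closure (StarAlgebra.adjoin ℂ {a | ∃ v M, siteOp v M = a} :
      Set (ConfigSpace →L[ℂ] ConfigSpace)) := x.2
  have himg : Obs.toOp '' (StarAlgebra.adjoin ℂ {a | ∃ v ∈ Set.univ, ∃ M, site v M = a} : Set Obs) =
      StarAlgebra.adjoin ℂ {a | ∃ v M, siteOp v M = a} := by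
    rw [← StarSubalgebra.coe_map, StarAlgHom.map_adjoin]
    congr 2
    ext a
    constructor
    · rintro ⟨_, ⟨v, -, M, rfl⟩, rfl⟩
      exact ⟨v, M, rfl⟩
    · rintro ⟨v, M, rfl⟩
      exact ⟨site v M, ⟨v, trivial, M, rfl⟩, rfl⟩
  rw [← himg] at hx
  exact closure_subtype.2 hx

/-- A closed property of observables that is stable under the `*`-algebra operations and holds for
the one-qubit observables holds for all of `𝒜`. -/
theorem Obs.mem_of_isClosed (S : StarSubalgebra ℂ Obs) (hS : IsClosed (S : Set Obs))
    (h : ∀ v M, site v M ∈ S) (a : Obs) : a ∈ S := by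
  have : localAlg Set.univ ≤ S := by
    refine StarSubalgebra.topologicalClosure_minimal (StarAlgebra.adjoin_le ?_) hS
    rintro _ ⟨v, -, M, rfl⟩
    exact h v M
  exact this (localAlg_univ ▸ trivial)

theorem site_mul (v : Vertex) (M N : Matrix (Fin 2) (Fin 2) ℂ) :
    site v (M * N) = site v M * site v N := Subtype.ext (siteOp_mul v M N)

theorem site_one (v : Vertex) : site v 1 = 1 := Subtype.ext (siteOp_one v)

theorem site_star (v : Vertex) (M : Matrix (Fin 2) (Fin 2) ℂ) :
    site v (star M) = star (site v M) := Subtype.ext (siteOp_star v M)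

theorem site_comm {v w : Vertex} (h : v ≠ w) (M N : Matrix (Fin 2) (Fin 2) ℂ) :
    site v M * site w N = site w N * site v M := Subtype.ext (siteOp_comm h M N)

/-! ### Stabilizers and the ground state -/

def sigmaX : Matrix (Fin 2) (Fin 2) ℂ := !![0, 1; 1, 0]

def sigmaZ : Matrix (Fin 2) (Fin 2) ℂ := !![1, 0; 0, -1]

/-- The product of the one-qubit operators `M` over the vertices in a list. -/
def siteProd (l : List Vertex) (M : Matrix (Fin 2) (Fin 2) ℂ) : Obs :=
  (l.map fun v => site v M).prod

/-- The stabilizer `K_f = ⨂_{v ∈ ∂f} σ_v^x`. -/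
def stabK (f : Face) : Obs := siteProd f.boundary sigmaX

/-- The stabilizer `J_f = ⨂_{v ∈ ∂f} σ_v^z`. -/
def stabJ (f : Face) : Obs := siteProd f.boundary sigmaZ

/-- The sum of all terms of the color code Hamiltonian that meet the finite set `Λ`. -/
def hamiltonian (Λ : Finset Vertex) : Obs :=
  -∑ f ∈ facesMeeting Λ, stabK f - ∑ f ∈ facesMeeting Λ, stabJ f

/-- The derivation `δ(A) = i [H, A]` on the observables `A` localized in the finite set `Λ`; the
terms of the Hamiltonian that do not meet `Λ` commute with `A`. -/
def derivation (Λ : Finset Vertex) (A : Obs) : Obs :=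
  Complex.I • (hamiltonian Λ * A - A * hamiltonian Λ)

/-- Linear functionals `ω` with `ω(a* a) ≥ 0` for all `a`; such an `ω` is a state if `ω 1 = 1`. -/
abbrev PosFunctional : Type := Obs →ₚ[ℂ] ℂ

/-- The action of the translation by `t` on the Hilbert space, `|s⟩ ↦ |s + t⟩`. -/
def translateOp (t : ℤ × ℤ) : ConfigSpace →L[ℂ] ConfigSpace :=
  weightedPerm (Equiv.finsetCongr (Equiv.subRight t)) (fun _ => 1) ⟨1, fun _ => by simp⟩

theorem translateOp_mem_unitary (t : ℤ × ℤ) :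
    translateOp t ∈ unitary (ConfigSpace →L[ℂ] ConfigSpace) := by
  rw [Unitary.mem_iff, translateOp, weightedPerm_adjoint _ _ _ ⟨1, fun _ => by simp⟩]
  constructor <;>
  · ext ψ s
    simp [mul_apply_eq_comp, -Equiv.finsetCongr_apply, -Equiv.finsetCongr_symm]

theorem translateOp_siteOp (t : ℤ × ℤ) (v : Vertex) (M : Matrix (Fin 2) (Fin 2) ℂ) :
    translateOp t * siteOp v M = siteOp (v + t) M * translateOp t := by
  have h1 : ∀ s, spin v (Equiv.finsetCongr (Equiv.subRight t) s) = spin (v + t) s := by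
    intro s
    simp [spin]
  have h2 : ∀ s, flip v (Equiv.finsetCongr (Equiv.subRight t) s) =
      Equiv.finsetCongr (Equiv.subRight t) (flip (v + t) s) := by
    intro s
    ext w
    simp [flip_apply, Finset.mem_symmDiff]
  ext ψ s
  simp only [mul_apply_eq_comp, translateOp, weightedPerm_apply, siteOp_apply, h1, h2, one_mul]

/-- The automorphism `a ↦ T_t a T_t*` of the bounded operators. -/
def translateConj (t : ℤ × ℤ) :
    (ConfigSpace →L[ℂ] ConfigSpace) →⋆ₐ[ℂ] (ConfigSpace →L[ℂ] ConfigSpace) :=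
  (Unitary.conjStarAlgAut ℂ _ ⟨translateOp t, translateOp_mem_unitary t⟩ :
    (ConfigSpace →L[ℂ] ConfigSpace) ≃⋆ₐ[ℂ] (ConfigSpace →L[ℂ] ConfigSpace))

theorem translateConj_apply (t : ℤ × ℤ) (a : ConfigSpace →L[ℂ] ConfigSpace) :
    translateConj t a = translateOp t * a * star (translateOp t) := rfl

theorem translateConj_siteOp (t : ℤ × ℤ) (v : Vertex) (M : Matrix (Fin 2) (Fin 2) ℂ) :
    translateConj t (siteOp v M) = siteOp (v + t) M := by
  rw [translateConj_apply, translateOp_siteOp, mul_assoc,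
    (Unitary.mem_iff.1 (translateOp_mem_unitary t)).2, mul_one]

theorem translateConj_mem (t : ℤ × ℤ) (a : Obs) :
    translateConj t (Obs.toOp a) ∈ quasiLocal := by
  have hc : Continuous (translateConj t) := by
    have : (translateConj t : (ConfigSpace →L[ℂ] ConfigSpace) → _) =
      fun a => translateOp t * a * star (translateOp t) := rfl
    rw [this]; fun_prop
  have hc' : Continuous Obs.toOp := continuous_subtype_val
  refine Obs.mem_of_isClosed (quasiLocal.comap ((translateConj t).comp Obs.toOp)) ?_ ?_ a
  · exact IsClosed.preimage (hc.comp hc') (StarSubalgebra.isClosed_topologicalClosure _)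
  · intro v M
    change translateConj t (siteOp v M) ∈ quasiLocal
    rw [translateConj_siteOp]
    exact (site (v + t) M).2

/-- The translation automorphism `τ_t` of `𝒜`. -/
def translate (t : ℤ × ℤ) : Obs →⋆ₐ[ℂ] Obs :=
  StarAlgHom.codRestrict ((translateConj t).comp Obs.toOp) quasiLocal (translateConj_mem t)

theorem translate_site (t : ℤ × ℤ) (v : Vertex) (M : Matrix (Fin 2) (Fin 2) ℂ) :
    translate t (site v M) = site (v + t) M := Subtype.ext (translateConj_siteOp t v M)

/-- `ω` is a translation invariant ground state of the color code.  The translations that map the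
lattice to itself are those by vectors `(p, q)` with `p + q` even. -/
structure IsInvariantGroundState (ω : PosFunctional) : Prop where
  map_one : ω 1 = 1
  ground : ∀ (Λ : Finset Vertex), ∀ A ∈ localAlg (Λ : Set Vertex),
    0 ≤ -Complex.I * ω (star A * derivation Λ A)
  invariant : ∀ t : ℤ × ℤ, Even (t.1 + t.2) → ∀ A : Obs, ω (translate t A) = ω A

/-! ### String operators and string automorphisms -/

/-- A half-infinite string of color `c`, `(f₀, v₀, v₁, f₁, v₂, v₃, f₂, …)`, without repeated
vertices: here `face i = f_i`, `src i = v_{2i}` and `tgt i = v_{2i+1}`. -/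
structure HalfString (c : Color) where
  face : ℕ → Face
  src : ℕ → Vertex
  tgt : ℕ → Vertex
  color_face : ∀ i, (face i).color = c
  face_ne : ∀ i, face i ≠ face (i + 1)
  src_mem : ∀ i, src i ∈ (face i).boundary
  tgt_mem : ∀ i, tgt i ∈ (face (i + 1)).boundary
  adj : ∀ i, lattice.Adj (src i) (tgt i)
  src_injective : Function.Injective src
  tgt_injective : Function.Injective tgt
  src_ne_tgt : ∀ i j, src i ≠ tgt j

/-- The string of color `c` that goes vertically downwards. -/
def verticalString : (c : Color) → HalfString c := fun c =>
  let x : ℤ := match c with | .r => 0 | .g => 1 | .b => 2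
  { face := fun i => ⟨(x, 1 - x - 2 * i), by simp only; exact ⟨-i, by ring⟩⟩
    src := fun i => (x + 1, 1 - x - 2 * i)
    tgt := fun i => (x + 1, 1 - x - 2 * i - 1)
    color_face := by intro i; cases c <;> simp [Face.color, x]
    face_ne := by intro i h; simp at h
    src_mem := by intro i; simp [Face.boundary, brick]
    tgt_mem := by
      intro i
      refine List.mem_map.2 ⟨(1, 1), by simp [brick], ?_⟩
      ext
      · simp
      · simp; ring
    adj := by
      intro i
      rw [lattice, SimpleGraph.fromRel_adj]
      refine ⟨fun h => by have := congrArg Prod.snd h; simp only at this; omega, Or.inr (Or.inr ⟨⟨-i + 0, by simp; ring⟩, by simp⟩)⟩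
    src_injective := by intro i j h; simpa using h
    tgt_injective := by intro i j h; simpa using h
    src_ne_tgt := by intro i j h; simp at h; omega }

/-- The support of the finite string formed by the first `n + 1` faces of `γ`. -/
def HalfString.vertices {c : Color} (γ : HalfString c) (n : ℕ) : List Vertex :=
  (List.range n).flatMap fun i => [γ.src i, γ.tgt i]

/-- The string operator of type `k` on the vertices in a list. -/
def stringOp (l : List Vertex) : Pauli → Obs
  | .x => siteProd l sigmaX
  | .z => siteProd l sigmaZ
  | .y => siteProd l sigmaX * siteProd l sigmaZ

theorem sigmaX_mem_unitary : sigmaX ∈ unitary (Matrix (Fin 2) (Fin 2) ℂ) := by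
  rw [Unitary.mem_iff]
  constructor <;>
  · ext i j
    fin_cases i <;> fin_cases j <;> simp [sigmaX, Matrix.mul_apply, Matrix.star_apply]

theorem sigmaZ_mem_unitary : sigmaZ ∈ unitary (Matrix (Fin 2) (Fin 2) ℂ) := by
  rw [Unitary.mem_iff]
  constructor <;>
  · ext i j
    fin_cases i <;> fin_cases j <;> simp [sigmaZ, Matrix.mul_apply, Matrix.star_apply]

theorem site_mem_unitary (v : Vertex) {M : Matrix (Fin 2) (Fin 2) ℂ}
    (hM : M ∈ unitary (Matrix (Fin 2) (Fin 2) ℂ)) : site v M ∈ unitary Obs := by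
  rw [Unitary.mem_iff] at hM ⊢
  rw [← site_star, ← site_mul, ← site_mul, hM.1, hM.2]
  exact ⟨site_one v, site_one v⟩

theorem siteProd_mem_unitary (l : List Vertex) {M : Matrix (Fin 2) (Fin 2) ℂ}
    (hM : M ∈ unitary (Matrix (Fin 2) (Fin 2) ℂ)) : siteProd l M ∈ unitary Obs := by
  refine Submonoid.list_prod_mem _ fun a ha => ?_
  obtain ⟨v, -, rfl⟩ := List.mem_map.1 ha
  exact site_mem_unitary v hM

theorem stringOp_mem_unitary (l : List Vertex) (k : Pauli) : stringOp l k ∈ unitary Obs := by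
  cases k
  · exact siteProd_mem_unitary l sigmaX_mem_unitary
  · exact Submonoid.mul_mem _ (siteProd_mem_unitary l sigmaX_mem_unitary)
      (siteProd_mem_unitary l sigmaZ_mem_unitary)
  · exact siteProd_mem_unitary l sigmaZ_mem_unitary

/-- The map `A ↦ S* A S` for the string operator `S` of type `k` on the vertices in a list. -/
def stringConj (l : List Vertex) (k : Pauli) : Obs →⋆ₐ[ℂ] Obs :=
  (Unitary.conjStarAlgAut ℂ Obs (star ⟨stringOp l k, stringOp_mem_unitary l k⟩) : Obs ≃⋆ₐ[ℂ] Obs)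

theorem stringConj_apply (l : List Vertex) (k : Pauli) (A : Obs) :
    stringConj l k A = star (stringOp l k) * A * stringOp l k := by
  change _ * A * star (star (stringOp l k)) = _
  rw [star_star]; rfl

/-- Conjugation of a one-qubit observable at `v` by `siteProd l P`. -/
theorem siteProd_conj_site (l : List Vertex) {P : Matrix (Fin 2) (Fin 2) ℂ}
    (hP : P ∈ unitary (Matrix (Fin 2) (Fin 2) ℂ)) (v : Vertex) (M : Matrix (Fin 2) (Fin 2) ℂ) :
    star (siteProd l P) * site v M * siteProd l P =
      site v (l.foldl (fun N w => if w = v then star P * N * P else N) M) := by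
  induction l generalizing M with
  | nil => simp [siteProd]
  | cons w l ih =>
    have h : star (site w P) * site v M * site w P =
        site v (if w = v then star P * M * P else M) := by
      split_ifs with hw
      · subst hw; rw [site_mul, site_mul, site_star]
      · rw [mul_assoc, site_comm (Ne.symm hw), ← mul_assoc,
          (Unitary.mem_iff.1 (site_mem_unitary w hP)).1, one_mul]
    have hc : siteProd (w :: l) P = site w P * siteProd l P := by simp [siteProd]
    rw [hc, List.foldl_cons, ← ih, ← h, star_mul]
    simp only [mul_assoc]

theorem HalfString.eventually_foldl {c : Color} (γ : HalfString c) (v : Vertex)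
    (P M : Matrix (Fin 2) (Fin 2) ℂ) : ∃ N : Matrix (Fin 2) (Fin 2) ℂ, ∀ᶠ n in Filter.atTop,
      (γ.vertices n).foldl (fun N w => if w = v then star P * N * P else N) M = N := by
  have h1 : ∀ᶠ n in Filter.atTop, γ.src n ≠ v := by
    have := γ.src_injective.tendsto_cofinite.eventually (Set.finite_singleton v).compl_mem_cofinite
    rwa [Nat.cofinite_eq_atTop] at this
  have h2 : ∀ᶠ n in Filter.atTop, γ.tgt n ≠ v := by
    have := γ.tgt_injective.tendsto_cofinite.eventually (Set.finite_singleton v).compl_mem_cofinite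
    rwa [Nat.cofinite_eq_atTop] at this
  obtain ⟨n₀, hn₀⟩ := Filter.eventually_atTop.1 (h1.and h2)
  refine ⟨(γ.vertices n₀).foldl (fun N w => if w = v then star P * N * P else N) M,
    Filter.eventually_atTop.2 ⟨n₀, fun n hn => ?_⟩⟩
  induction n, hn using Nat.le_induction with
  | base => rfl
  | succ n hn ih =>
    rw [← ih, HalfString.vertices, List.range_succ, List.flatMap_append, List.foldl_append,
      ← HalfString.vertices]
    simp [(hn₀ n hn).1, (hn₀ n hn).2]

/-- The sequence `S_{γ_n}* A S_{γ_n}` is eventually constant for a one-qubit observable `A`. -/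
theorem HalfString.exists_lim_site {c : Color} (γ : HalfString c) (k : Pauli) (v : Vertex)
    (M : Matrix (Fin 2) (Fin 2) ℂ) :
    ∃ b, Filter.Tendsto (fun n => stringConj (γ.vertices n) k (site v M)) Filter.atTop (nhds b) := by
  suffices ∃ N, ∀ᶠ n in Filter.atTop, stringConj (γ.vertices n) k (site v M) = site v N by
    obtain ⟨N, hN⟩ := this
    exact ⟨site v N, tendsto_const_nhds.congr' (hN.mono fun n hn => hn.symm)⟩
  cases k
  · obtain ⟨N, hN⟩ := γ.eventually_foldl v sigmaX M
    exact ⟨N, hN.mono fun n hn => by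
      rw [stringConj_apply, stringOp, siteProd_conj_site _ sigmaX_mem_unitary, hn]⟩
  · obtain ⟨N, hN⟩ := γ.eventually_foldl v sigmaX M
    obtain ⟨N', hN'⟩ := γ.eventually_foldl v sigmaZ N
    refine ⟨N', (hN.and hN').mono fun n hn => ?_⟩
    have := siteProd_conj_site (γ.vertices n) sigmaX_mem_unitary v M
    rw [hn.1] at this
    have h' := siteProd_conj_site (γ.vertices n) sigmaZ_mem_unitary v N
    rw [hn.2, ← this] at h'
    rw [stringConj_apply, stringOp, ← h', star_mul]
    simp only [mul_assoc]
  · obtain ⟨N, hN⟩ := γ.eventually_foldl v sigmaZ M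
    exact ⟨N, hN.mono fun n hn => by
      rw [stringConj_apply, stringOp, siteProd_conj_site _ sigmaZ_mem_unitary, hn]⟩

/-- Pointwise convergence of `*`-homomorphisms on the one-qubit observables extends to `𝒜`. -/
theorem exists_lim_of_site (φ : ℕ → Obs →⋆ₐ[ℂ] Obs)
    (h : ∀ v M, ∃ b, Filter.Tendsto (fun n => φ n (site v M)) Filter.atTop (nhds b)) (a : Obs) :
    ∃ b, Filter.Tendsto (fun n => φ n a) Filter.atTop (nhds b) := by
  let S : StarSubalgebra ℂ Obs :=
    { carrier := {a | ∃ b, Filter.Tendsto (fun n => φ n a) Filter.atTop (nhds b)}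
      mul_mem' := fun ⟨b, hb⟩ ⟨c, hc⟩ => ⟨b * c, by simpa using hb.mul hc⟩
      add_mem' := fun ⟨b, hb⟩ ⟨c, hc⟩ => ⟨b + c, by simpa using hb.add hc⟩
      algebraMap_mem' := fun r => ⟨algebraMap ℂ Obs r, by
        simpa only [AlgHomClass.commutes] using tendsto_const_nhds⟩
      star_mem' := fun ⟨b, hb⟩ => ⟨star b, by simpa only [map_star] using hb.star⟩ }
  refine Obs.mem_of_isClosed S ?_ h a
  refine isClosed_of_closure_subset fun a ha => ?_
  refine cauchySeq_tendsto_of_complete (Metric.cauchySeq_iff'.2 fun ε hε => ?_)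
  obtain ⟨a', ⟨b, hb⟩, hd⟩ := Metric.mem_closure_iff.1 ha (ε / 3) (by positivity)
  obtain ⟨N, hN⟩ := Metric.cauchySeq_iff'.1 hb.cauchySeq (ε / 3) (by positivity)
  refine ⟨N, fun n hn => ?_⟩
  have hφ : ∀ m, dist (φ m a) (φ m a') < ε / 3 := fun m => by
    rw [dist_eq_norm, ← map_sub]
    refine lt_of_le_of_lt (NonUnitalStarAlgHom.norm_apply_le (φ m) _) ?_
    rwa [← dist_eq_norm]
  have h1 := dist_triangle4 (φ n a) (φ n a') (φ N a') (φ N a)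
  have h2 := hφ n
  have h3 := hN n hn
  have h4 := hφ N
  rw [dist_comm] at h4
  linarith

theorem HalfString.exists_lim {c : Color} (γ : HalfString c) (k : Pauli) (A : Obs) :
    ∃ b, Filter.Tendsto (fun n => stringConj (γ.vertices n) k A) Filter.atTop (nhds b) :=
  exists_lim_of_site _ (γ.exists_lim_site k) A

/-- `ρ_γ^{ck}(A) = lim_n S_{γ_n}* A S_{γ_n}`, as a function on `𝒜`. -/
def HalfString.rhoFun {c : Color} (γ : HalfString c) (k : Pauli) (A : Obs) : Obs :=
  (γ.exists_lim k A).choose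

theorem HalfString.tendsto_rhoFun {c : Color} (γ : HalfString c) (k : Pauli) (A : Obs) :
    Filter.Tendsto (fun n => stringConj (γ.vertices n) k A) Filter.atTop (nhds (γ.rhoFun k A)) :=
  (γ.exists_lim k A).choose_spec

/-- The endomorphism `ρ_γ^{ck}` of `𝒜`. -/
def HalfString.rho {c : Color} (γ : HalfString c) (k : Pauli) : Obs →⋆ₐ[ℂ] Obs where
  toFun := γ.rhoFun k
  map_one' := tendsto_nhds_unique (γ.tendsto_rhoFun k 1) (by
    simpa only [map_one] using tendsto_const_nhds)
  map_mul' a b := tendsto_nhds_unique (γ.tendsto_rhoFun k (a * b)) (by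
    simpa only [map_mul] using (γ.tendsto_rhoFun k a).mul (γ.tendsto_rhoFun k b))
  map_zero' := tendsto_nhds_unique (γ.tendsto_rhoFun k 0) (by
    simpa only [map_zero] using tendsto_const_nhds)
  map_add' a b := tendsto_nhds_unique (γ.tendsto_rhoFun k (a + b)) (by
    simpa only [map_add] using (γ.tendsto_rhoFun k a).add (γ.tendsto_rhoFun k b))
  commutes' r := tendsto_nhds_unique (γ.tendsto_rhoFun k (algebraMap ℂ Obs r)) (by
    simpa only [AlgHomClass.commutes] using tendsto_const_nhds)
  map_star' a := tendsto_nhds_unique (γ.tendsto_rhoFun k (star a)) (by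
    simpa only [map_star] using (γ.tendsto_rhoFun k a).star)

/-! ### Representations and superselection sectors -/

/-- The functional `ω ∘ ρ`. -/
def pullback (ω : PosFunctional) (ρ : Obs →⋆ₐ[ℂ] Obs) : PosFunctional :=
  ω.comp (PositiveLinearMap.ofClass ρ)

theorem pullback_apply (ω : PosFunctional) (ρ : Obs →⋆ₐ[ℂ] Obs) (a : Obs) :
    pullback ω ρ a = ω (ρ a) := rfl

/-- The GNS representations of `ω₁` and `ω₂`, restricted to the observables in `B`, are unitarily
equivalent. -/
def EquivOn (B : StarSubalgebra ℂ Obs) (ω₁ ω₂ : PosFunctional) : Prop :=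
  ∃ U : ω₁.GNS ≃ₗᵢ[ℂ] ω₂.GNS, ∀ a ∈ B, ∀ ξ : ω₁.GNS,
    U (ω₁.gnsStarAlgHom a ξ) = ω₂.gnsStarAlgHom a (U ξ)

/-- The GNS representations of `ω₁` and `ω₂` are unitarily equivalent. -/
def GNSEquiv (ω₁ ω₂ : PosFunctional) : Prop := EquivOn ⊤ ω₁ ω₂

/-- The position of a vertex in the plane. -/
def position (v : Vertex) : EuclideanSpace ℝ (Fin 2) := !₂[(v.1 : ℝ), (v.2 : ℝ)]

/-- The vertices in the cone with apex `p`, axis `a` and half-opening angle `θ`. -/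
def cone (p a : EuclideanSpace ℝ (Fin 2)) (θ : ℝ) : Set Vertex :=
  {v | ‖position v - p‖ * Real.cos θ < inner ℝ (position v - p) a}

/-- The GNS representation of `ω` satisfies the superselection criterion with respect to the GNS
representation of `ω₀`. -/
def IsSuperselectionSector (ω₀ ω : PosFunctional) : Prop :=
  ∀ (p a : EuclideanSpace ℝ (Fin 2)) (θ : ℝ), ‖a‖ = 1 → 0 < θ → θ < Real.pi →
    EquivOn (localAlg (cone p a θ)ᶜ) ω ω₀

/-- A string type `ck`: a color together with a Pauli label. -/
structure StringType where
  color : Color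
  pauli : Pauli

/-- The state `ω₀ ∘ ρ_γ^{ck}`, whose GNS representation is `π^{ck}`. -/
def stringState (ω₀ : PosFunctional) (s : StringType) (γ : HalfString s.color) : PosFunctional :=
  pullback ω₀ (γ.rho s.pauli)

/-- The state `ω₀ ∘ ρ_γ^{ck} ∘ ρ_γ'^{c'k'}`, whose GNS representation is `π^{ck,c'k'}`. -/
def compositeState (ω₀ : PosFunctional) (s t : StringType)
    (γ : HalfString s.color) (γ' : HalfString t.color) : PosFunctional :=
  pullback ω₀ ((γ.rho s.pauli).comp (γ'.rho t.pauli))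

def rx : StringType := ⟨.r, .x⟩
def ry : StringType := ⟨.r, .y⟩
def rz : StringType := ⟨.r, .z⟩
def gx : StringType := ⟨.g, .x⟩
def gy : StringType := ⟨.g, .y⟩
def gz : StringType := ⟨.g, .z⟩
def bx : StringType := ⟨.b, .x⟩
/-- The type blue-`y` (`by` is a reserved word). -/
def bY : StringType := ⟨.b, .y⟩
def bz : StringType := ⟨.b, .z⟩

/-- The three pairs of bosonic strings for each of the six fermions `f₁, …, f₆`. -/
def fermionPairs : Fin 6 → Fin 3 → StringType × StringType :=
  ![![(rx, bz), (ry, gz), (gx, bY)],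
    ![(rz, bx), (ry, gx), (gz, bY)],
    ![(bz, gy), (gx, rz), (bx, ry)],
    ![(rz, gy), (gx, bz), (rx, bY)],
    ![(rx, gy), (bx, gz), (bY, rz)],
    ![(bx, gy), (rx, gz), (ry, bz)]]

end ColorCode

end

open ColorCode

noncomputable section

namespace ColorCode

open Filter Topology

/-! ### Signs and the parity pairing -/

/-! Everything reduces to linear algebra over `ZMod 2`. A Pauli operator is a pair of finite vertex
sets, and commuting one past a stabilizer costs a sign given by the parity of an intersection. The
operator `op k a` therefore flips exactly the stabilizers `chk k f` with `f` in `bdry a`, the faces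
meeting `a` in an odd number of vertices. Two bricks share an even number of vertices, so all
stabilizers commute.

A state with sharp values of all stabilizers is determined by these values (`HasSyndrome.unique`): a
Pauli operator with nonempty boundary anticommutes with a check and has expectation zero, and one
without boundary is a product of checks because the plane has no homology (`cycle_induction`). The
ground state is the state with no excitations. Conversely, a ground state cannot contain two
excitations of the same color and type, since a string operator would annihilate them; translation
invariance then excludes even one (`IsInvariantGroundState.hasSyndrome`).

Finite sets of excitations modulo boundaries are classified by `charge`. A string moves an
excitation to any face of the same color, and a single vertex creates one excitation of each color,
so the colors become the three nonzero elements of a group of order four, with sum zero. Equal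
charges give states related by a local unitary (`HasSyndrome.gnsEquiv`). Different charges are told
apart by arbitrarily distant loop operators (`HasSyndrome.not_gnsEquiv`). Every charge can be
created by an automorphism localized in a prescribed cone, which gives the superselection criterion.

The Pauli labels likewise are the nonzero elements of a group of order four, and the charge of a
string is the tensor `c ⊗ k`. The sixteen charges are zero, nine pure tensors (the bosons) and six
tensors of rank two (the fermions). With `c ≠ c'` and `k ≠ k'` the sum `c ⊗ k + c' ⊗ k'` has rank
two, and every tensor of rank two has three such decompositions: this is the table. -/

/-- The character `0 ↦ 1`, `1 ↦ -1` of `ZMod 2`. -/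
def sgn (z : ZMod 2) : ℂ := if z = 0 then 1 else -1

@[simp] theorem sgn_zero : sgn 0 = 1 := by simp [sgn]

@[simp] theorem sgn_one : sgn 1 = -1 := by simp [sgn]

theorem zmod_two_cases (z : ZMod 2) : z = 0 ∨ z = 1 := by
  revert z; decide

theorem sgn_add (y z : ZMod 2) : sgn (y + z) = sgn y * sgn z := by
  rcases zmod_two_cases y with rfl | rfl <;> rcases zmod_two_cases z with rfl | rfl <;>
    simp [show (1 : ZMod 2) + 1 = 0 from rfl]

@[simp] theorem sgn_mul_self (z : ZMod 2) : sgn z * sgn z = 1 := by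
  rcases zmod_two_cases z with rfl | rfl <;> simp

/-- The parity of the number of common elements of two finite sets. -/
def pair {α : Type*} [DecidableEq α] (a b : Finset α) : ZMod 2 := ((a ∩ b).card : ZMod 2)

section pair

variable {α : Type*} [DecidableEq α]

theorem pair_eq_sum (a b : Finset α) : pair a b = ∑ v ∈ b, if v ∈ a then 1 else 0 := by
  rw [pair, ← Finset.sum_filter, Finset.sum_const, nsmul_eq_mul, mul_one, Finset.inter_comm,
    Finset.filter_mem_eq_inter]

theorem pair_comm (a b : Finset α) : pair a b = pair b a := by
  rw [pair, pair, Finset.inter_comm]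

theorem ite_mem_symmDiff (a b : Finset α) (v : α) :
    (if v ∈ symmDiff a b then (1 : ZMod 2) else 0) =
      (if v ∈ a then 1 else 0) + if v ∈ b then 1 else 0 := by
  by_cases ha : v ∈ a <;> by_cases hb : v ∈ b <;>
    simp [Finset.mem_symmDiff, ha, hb, show (1 : ZMod 2) + 1 = 0 from rfl]

theorem pair_symmDiff_left (a a' b : Finset α) :
    pair (symmDiff a a') b = pair a b + pair a' b := by
  simp only [pair_eq_sum, ite_mem_symmDiff, Finset.sum_add_distrib]

theorem pair_symmDiff_right (a b b' : Finset α) :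
    pair a (symmDiff b b') = pair a b + pair a b' := by
  rw [pair_comm, pair_symmDiff_left, pair_comm b, pair_comm b']

@[simp] theorem pair_empty_left (b : Finset α) : pair ∅ b = 0 := by simp [pair]

@[simp] theorem pair_empty_right (b : Finset α) : pair b ∅ = 0 := by simp [pair]

theorem pair_singleton_right (a : Finset α) (v : α) :
    pair a {v} = if v ∈ a then 1 else 0 := by rw [pair_eq_sum, Finset.sum_singleton]

theorem pair_singleton_left (a : Finset α) (v : α) :
    pair {v} a = if v ∈ a then 1 else 0 := by rw [pair_comm, pair_singleton_right]

theorem insert_eq_symmDiff {f : α} {s : Finset α} (h : f ∉ s) :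
    insert f s = symmDiff {f} s := by
  have : Disjoint ({f} : Finset α) s := by simpa using h
  rw [this.symmDiff_eq_sup, Finset.insert_eq]; rfl

end pair

/-! ### Pauli operators -/

theorem toOp_injective : Function.Injective Obs.toOp := Subtype.val_injective

theorem Obs.ext_apply {a b : Obs} (h : ∀ ψ s, Obs.toOp a ψ s = Obs.toOp b ψ s) : a = b := by
  apply toOp_injective
  ext ψ s
  exact h ψ s

theorem toOp_mul_apply (a b : Obs) (ψ : ConfigSpace) :
    Obs.toOp (a * b) ψ = Obs.toOp a (Obs.toOp b ψ) := by
  rw [map_mul]; rfl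

theorem toOp_smul_apply (c : ℂ) (b : Obs) (ψ : ConfigSpace) (s) :
    Obs.toOp (c • b) ψ s = c * Obs.toOp b ψ s := by
  rw [map_smul]; rfl

theorem toOp_site_sigmaX (v : Vertex) (ψ : ConfigSpace) (s) :
    Obs.toOp (site v sigmaX) ψ s = ψ (symmDiff s {v}) := by
  change siteOp v sigmaX ψ s = _
  rw [siteOp_apply, flip_apply]
  rcases Fin.exists_fin_two.1 ⟨spin v s, rfl⟩ with h | h <;> rw [h] <;> simp [sigmaX]

theorem toOp_site_sigmaZ (v : Vertex) (ψ : ConfigSpace) (s) :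
    Obs.toOp (site v sigmaZ) ψ s = sgn (pair s {v}) * ψ s := by
  change siteOp v sigmaZ ψ s = _
  rw [siteOp_apply, pair_singleton_right]
  by_cases h : v ∈ s <;> simp [spin, h, sigmaZ]

/-- The Pauli matrix `σ^x` (for `false`) or `σ^z` (for `true`). -/
def pauliMatrix : Bool → Matrix (Fin 2) (Fin 2) ℂ
  | false => sigmaX
  | true => sigmaZ

theorem pauliMatrix_mem_unitary (k : Bool) :
    pauliMatrix k ∈ unitary (Matrix (Fin 2) (Fin 2) ℂ) := by
  cases k
  exacts [sigmaX_mem_unitary, sigmaZ_mem_unitary]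

/-- The product of the operators `σ^x` (for `false`) or `σ^z` (for `true`) over a finite set. -/
def op (k : Bool) (a : Finset Vertex) : Obs := siteProd a.toList (pauliMatrix k)

theorem siteProd_cons (v : Vertex) (l : List Vertex) (M) :
    siteProd (v :: l) M = site v M * siteProd l M := by
  simp [siteProd]

theorem toFinset_cons_eq_symmDiff {v : Vertex} {l : List Vertex} (h : v ∉ l) :
    (v :: l).toFinset = symmDiff {v} l.toFinset := by
  rw [List.toFinset_cons, insert_eq_symmDiff (by simpa using h)]

theorem toOp_siteProd_sigmaX {l : List Vertex} (hl : l.Nodup) (ψ : ConfigSpace) (s) :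
    Obs.toOp (siteProd l sigmaX) ψ s = ψ (symmDiff s l.toFinset) := by
  induction l generalizing s with
  | nil => simp [siteProd, ← Finset.bot_eq_empty]
  | cons v l ih =>
    rw [siteProd_cons, toOp_mul_apply, toOp_site_sigmaX, ih (List.nodup_cons.1 hl).2,
      toFinset_cons_eq_symmDiff (List.nodup_cons.1 hl).1, symmDiff_assoc]

theorem toOp_siteProd_sigmaZ {l : List Vertex} (hl : l.Nodup) (ψ : ConfigSpace) (s) :
    Obs.toOp (siteProd l sigmaZ) ψ s = sgn (pair s l.toFinset) * ψ s := by
  induction l with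
  | nil => simp [siteProd]
  | cons v l ih =>
    rw [siteProd_cons, toOp_mul_apply, toOp_site_sigmaZ, ih (List.nodup_cons.1 hl).2,
      toFinset_cons_eq_symmDiff (List.nodup_cons.1 hl).1, pair_symmDiff_right, sgn_add, mul_assoc]

theorem toOp_op_false (a : Finset Vertex) (ψ : ConfigSpace) (s) :
    Obs.toOp (op false a) ψ s = ψ (symmDiff s a) := by
  rw [op, pauliMatrix, toOp_siteProd_sigmaX a.nodup_toList, Finset.toList_toFinset]

theorem toOp_op_true (a : Finset Vertex) (ψ : ConfigSpace) (s) :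
    Obs.toOp (op true a) ψ s = sgn (pair s a) * ψ s := by
  rw [op, pauliMatrix, toOp_siteProd_sigmaZ a.nodup_toList, Finset.toList_toFinset]

theorem siteProd_eq_op {l : List Vertex} (hl : l.Nodup) (k : Bool) :
    siteProd l (pauliMatrix k) = op k l.toFinset := by
  apply Obs.ext_apply
  intro ψ s
  cases k
  · rw [toOp_op_false, pauliMatrix, toOp_siteProd_sigmaX hl]
  · rw [toOp_op_true, pauliMatrix, toOp_siteProd_sigmaZ hl]

theorem op_mul (k : Bool) (a b : Finset Vertex) : op k a * op k b = op k (symmDiff a b) := by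
  apply Obs.ext_apply
  intro ψ s
  rw [toOp_mul_apply]
  cases k
  · simp only [toOp_op_false, symmDiff_assoc]
  · simp only [toOp_op_true, pair_symmDiff_right, sgn_add, mul_assoc]

@[simp] theorem op_empty (k : Bool) : op k ∅ = 1 := by
  simp [op, siteProd]

theorem op_mul_self (k : Bool) (a : Finset Vertex) : op k a * op k a = 1 := by
  simp [op_mul]

theorem op_mem_unitary (k : Bool) (a : Finset Vertex) : op k a ∈ unitary Obs :=
  siteProd_mem_unitary _ (pauliMatrix_mem_unitary k)

@[simp] theorem op_star (k : Bool) (a : Finset Vertex) : star (op k a) = op k a := by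
  calc star (op k a) = star (op k a) * (op k a * op k a) := by rw [op_mul_self, mul_one]
    _ = op k a := by rw [← mul_assoc, (Unitary.mem_iff.1 (op_mem_unitary k a)).1, one_mul]

theorem op_commute (k : Bool) (a b : Finset Vertex) : op k a * op k b = op k b * op k a := by
  rw [op_mul, op_mul, symmDiff_comm]

theorem op_mul_op_not (k : Bool) (a b : Finset Vertex) :
    op k a * op (!k) b = sgn (pair a b) • (op (!k) b * op k a) := by
  have key : ∀ a b, op false a * op true b = sgn (pair a b) • (op true b * op false a) := by
    intro a b
    apply Obs.ext_apply
    intro ψ s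
    simp only [toOp_mul_apply, toOp_smul_apply, toOp_op_true, toOp_op_false, pair_symmDiff_left,
      sgn_add]
    ring
  cases k
  · exact key a b
  · simp only [Bool.not_true]
    rw [key b a, smul_smul, pair_comm, sgn_mul_self, one_smul]

theorem op_singleton (k : Bool) (v : Vertex) : op k {v} = site v (pauliMatrix k) := by
  simp [op, siteProd]

/-! ### Density of the Pauli operators -/

theorem site_add (v : Vertex) (M N : Matrix (Fin 2) (Fin 2) ℂ) :
    site v (M + N) = site v M + site v N := by
  apply toOp_injective
  ext ψ s
  change siteOp v (M + N) ψ s = siteOp v M ψ s + siteOp v N ψ s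
  simp only [siteOp_apply, Matrix.add_apply]
  ring

theorem site_smul (v : Vertex) (c : ℂ) (M : Matrix (Fin 2) (Fin 2) ℂ) :
    site v (c • M) = c • site v M := by
  apply toOp_injective
  ext ψ s
  change siteOp v (c • M) ψ s = c * siteOp v M ψ s
  simp only [siteOp_apply, Matrix.smul_apply, smul_eq_mul]
  ring

theorem matrix_eq_pauli (M : Matrix (Fin 2) (Fin 2) ℂ) :
    M = ((M 0 0 + M 1 1) / 2) • (1 : Matrix (Fin 2) (Fin 2) ℂ) + ((M 0 0 - M 1 1) / 2) • sigmaZ +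
      ((M 0 1 + M 1 0) / 2) • sigmaX + ((M 1 0 - M 0 1) / 2) • (sigmaX * sigmaZ) := by
  ext i j
  fin_cases i <;> fin_cases j <;> simp [sigmaX, sigmaZ] <;> ring

/-- The Pauli operators `X(a) Z(b)`. -/
def paulis : Set Obs := Set.range fun p : Finset Vertex × Finset Vertex => op false p.1 * op true p.2

theorem pauli_mul (a b a' b' : Finset Vertex) :
    op false a * op true b * (op false a' * op true b') =
      sgn (pair b a') • (op false (symmDiff a a') * op true (symmDiff b b')) := by
  have h := op_mul_op_not true b a'
  rw [Bool.not_true] at h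
  rw [← op_mul, ← op_mul, mul_assoc, ← mul_assoc (op true b), h]
  simp only [smul_mul_assoc, mul_smul_comm, mul_assoc]

theorem pauli_star (a b : Finset Vertex) :
    star (op false a * op true b) = sgn (pair b a) • (op false a * op true b) := by
  rw [star_mul, op_star, op_star]
  exact op_mul_op_not true b a

/-- The linear combinations of Pauli operators. -/
def pauliSpan : StarSubalgebra ℂ Obs where
  carrier := Submodule.span ℂ paulis
  mul_mem' {x y} hx hy := by
    refine Submodule.span_induction₂ (p := fun x y _ _ => x * y ∈ Submodule.span ℂ paulis)
      ?_ ?_ ?_ ?_ ?_ ?_ ?_ hx hy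
    · rintro _ _ ⟨⟨a, b⟩, rfl⟩ ⟨⟨a', b'⟩, rfl⟩
      rw [pauli_mul]
      exact Submodule.smul_mem _ _ (Submodule.subset_span ⟨(_, _), rfl⟩)
    · intros; simp
    · intros; simp
    · intro x y z _ _ _ h h'; rw [add_mul]; exact add_mem h h'
    · intro x y z _ _ _ h h'; rw [mul_add]; exact add_mem h h'
    · intro r x y _ _ h; rw [smul_mul_assoc]; exact Submodule.smul_mem _ _ h
    · intro r x y _ _ h; rw [mul_smul_comm]; exact Submodule.smul_mem _ _ h
  add_mem' hx hy := add_mem (S := Submodule ℂ Obs) hx hy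
  algebraMap_mem' r := by
    rw [Algebra.algebraMap_eq_smul_one]
    exact Submodule.smul_mem _ _ (Submodule.subset_span ⟨(∅, ∅), by simp⟩)
  star_mem' {x} hx := by
    refine Submodule.span_induction (p := fun x _ => star x ∈ Submodule.span ℂ paulis)
      ?_ ?_ ?_ ?_ hx
    · rintro _ ⟨⟨a, b⟩, rfl⟩
      rw [pauli_star]
      exact Submodule.smul_mem _ _ (Submodule.subset_span ⟨(_, _), rfl⟩)
    · simp
    · intro x y _ _ h h'; rw [star_add]; exact add_mem h h'
    · intro r x _ h; rw [star_smul]; exact Submodule.smul_mem _ _ h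

theorem site_mem_pauliSpan (v : Vertex) (M) : site v M ∈ pauliSpan := by
  have hX : op false {v} ∈ pauliSpan := Submodule.subset_span ⟨({v}, ∅), by simp⟩
  have hZ : op true {v} ∈ pauliSpan := Submodule.subset_span ⟨(∅, {v}), by simp⟩
  rw [op_singleton] at hX hZ
  rw [matrix_eq_pauli M, site_add, site_add, site_add, site_smul, site_smul, site_smul, site_smul,
    site_one, site_mul]
  exact add_mem (add_mem (add_mem (pauliSpan.smul_mem (one_mem _) _) (pauliSpan.smul_mem hZ _))
    (pauliSpan.smul_mem hX _)) (pauliSpan.smul_mem (mul_mem hX hZ) _)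

theorem dense_pauliSpan : Dense (pauliSpan : Set Obs) := by
  intro a
  exact Obs.mem_of_isClosed pauliSpan.topologicalClosure
    (StarSubalgebra.isClosed_topologicalClosure _)
    (fun v M => StarSubalgebra.le_topologicalClosure _ (site_mem_pauliSpan v M)) a

theorem PosFunctional.continuous (ω : PosFunctional) : Continuous ω :=
  map_continuous ω

/-- Two positive functionals that agree on the Pauli operators are equal. -/
theorem posFunctional_ext {ω ω' : PosFunctional}
    (h : ∀ a b, ω (op false a * op true b) = ω' (op false a * op true b)) : ω = ω' := by
  have h1 : Set.EqOn ω ω' (pauliSpan : Set Obs) := by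
    intro x hx
    refine Submodule.span_induction (p := fun x _ => ω x = ω' x) ?_ ?_ ?_ ?_ hx
    · rintro _ ⟨⟨a, b⟩, rfl⟩
      exact h a b
    · simp
    · intro x y _ _ h h'; simp [h, h']
    · intro r x _ h; simp [h]
  exact DFunLike.coe_injective
    (Continuous.ext_on dense_pauliSpan (PosFunctional.continuous ω) (PosFunctional.continuous ω') h1)

/-! ### Locality -/

theorem site_mem_localAlg {Λ : Set Vertex} {v : Vertex} (hv : v ∈ Λ) (M) :
    site v M ∈ localAlg Λ :=
  StarSubalgebra.le_topologicalClosure _ (StarAlgebra.subset_adjoin ℂ _ ⟨v, hv, M, rfl⟩)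

theorem op_mem_localAlg {Λ : Set Vertex} (k : Bool) {a : Finset Vertex} (ha : (a : Set Vertex) ⊆ Λ) :
    op k a ∈ localAlg Λ := by
  refine list_prod_mem fun x hx => ?_
  obtain ⟨v, hv, rfl⟩ := List.mem_map.1 hx
  exact site_mem_localAlg (ha (by simpa using hv)) _

theorem siteProd_comm_site {l : List Vertex} {v : Vertex} (h : v ∉ l) (M N) :
    siteProd l M * site v N = site v N * siteProd l M := by
  refine (Commute.list_prod_left _ _ fun x hx => ?_ : Commute (siteProd l M) (site v N))
  obtain ⟨w, hw, rfl⟩ := List.mem_map.1 hx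
  exact site_comm (by rintro rfl; exact h hw) _ _

theorem op_comm_site {k : Bool} {a : Finset Vertex} {v : Vertex} (h : v ∉ a) (N) :
    op k a * site v N = site v N * op k a :=
  siteProd_comm_site (by simpa using h) _ _

/-! ### The boundary map -/

/-- The six vertices of a face, as a finite set. -/
def bd (f : Face) : Finset Vertex := f.boundary.toFinset

theorem mem_boundary_iff {f : Face} {v : Vertex} : v ∈ f.boundary ↔
    f.1.1 ≤ v.1 ∧ v.1 ≤ f.1.1 + 2 ∧ f.1.2 ≤ v.2 ∧ v.2 ≤ f.1.2 + 1 := by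
  obtain ⟨x, y⟩ := v
  simp only [Face.boundary, brick, List.map_cons, List.map_nil, List.mem_cons,
    List.not_mem_nil, or_false, Prod.ext_iff, Prod.fst_add, Prod.snd_add]
  omega

theorem mem_bd {f : Face} {v : Vertex} : v ∈ bd f ↔
    f.1.1 ≤ v.1 ∧ v.1 ≤ f.1.1 + 2 ∧ f.1.2 ≤ v.2 ∧ v.2 ≤ f.1.2 + 1 := by
  rw [bd, List.mem_toFinset, mem_boundary_iff]

theorem boundary_nodup (f : Face) : f.boundary.Nodup :=
  List.Nodup.map (add_right_injective _) (by decide)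

theorem stabK_eq (f : Face) : stabK f = op false (bd f) :=
  siteProd_eq_op (boundary_nodup f) false

theorem stabJ_eq (f : Face) : stabJ f = op true (bd f) :=
  siteProd_eq_op (boundary_nodup f) true

theorem mem_facesMeeting_iff {Λ : Finset Vertex} {f : Face} :
    f ∈ facesMeeting Λ ↔ ∃ v ∈ bd f, v ∈ Λ := by
  simp [mem_facesMeeting, bd]

/-- The faces that have an odd number of vertices in a finite set. -/
def bdry (a : Finset Vertex) : Finset Face := (facesMeeting a).filter fun f => pair a (bd f) = 1

theorem pair_bdry (a : Finset Vertex) (f : Face) : pair (bdry a) {f} = pair a (bd f) := by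
  simp only [pair_singleton_right, bdry, Finset.mem_filter, mem_facesMeeting_iff]
  by_cases h : ∃ v ∈ bd f, v ∈ a
  · rcases zmod_two_cases (pair a (bd f)) with h' | h' <;> simp [h, h']
  · have h' : pair a (bd f) = 0 := by
      rw [pair_eq_sum]
      exact Finset.sum_eq_zero fun v hv => if_neg fun hva => h ⟨v, hv, hva⟩
    simp [h']

theorem finset_ext_pair {α : Type*} [DecidableEq α] {a b : Finset α}
    (h : ∀ f, pair a {f} = pair b {f}) : a = b := by
  ext f
  have := h f
  rw [pair_singleton_right, pair_singleton_right] at this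
  by_cases ha : f ∈ a <;> by_cases hb : f ∈ b <;> simp_all

theorem bdry_symmDiff (a b : Finset Vertex) : bdry (symmDiff a b) = symmDiff (bdry a) (bdry b) :=
  finset_ext_pair fun f => by simp only [pair_symmDiff_left, pair_bdry]

@[simp] theorem bdry_empty : bdry ∅ = ∅ := finset_ext_pair fun f => by simp [pair_bdry]

theorem pair_bd (a : Finset Vertex) (f : Face) : pair a (bd f) =
    (if (f.1.1, f.1.2) ∈ a then 1 else 0) + (if (f.1.1 + 1, f.1.2) ∈ a then 1 else 0) +
    (if (f.1.1 + 2, f.1.2) ∈ a then 1 else 0) + (if (f.1.1, f.1.2 + 1) ∈ a then 1 else 0) +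
    (if (f.1.1 + 1, f.1.2 + 1) ∈ a then 1 else 0) +
    (if (f.1.1 + 2, f.1.2 + 1) ∈ a then 1 else 0) := by
  obtain ⟨⟨x, y⟩, h⟩ := f
  rw [pair_eq_sum, bd, List.sum_toFinset _ (boundary_nodup _)]
  simp [Face.boundary, brick, add_assoc]

/-- Distinct bricks share either nothing or the two ends of one edge, and a brick has six vertices.
This evenness is what makes the `σ^x` and `σ^z` stabilizers commute. -/
theorem pair_bd_bd (f g : Face) : pair (bd f) (bd g) = 0 := by
  obtain ⟨⟨x, y⟩, h⟩ := f
  obtain ⟨⟨x', y'⟩, h'⟩ := g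
  simp only [pair_bd, mem_bd]
  simp only [Int.odd_iff] at h h'
  split_ifs <;> first | rfl | (exfalso; omega)

theorem bdry_bd (f : Face) : bdry (bd f) = ∅ :=
  finset_ext_pair fun g => by rw [pair_bdry, pair_bd_bd, pair_empty_left]

/-- Every finite set of vertices that meets all faces in an even number of vertices is a sum of
boundaries of faces. -/
theorem cycle_induction {p : Finset Vertex → Prop} (h0 : p ∅)
    (hs : ∀ a f, p a → p (symmDiff a (bd f))) {a : Finset Vertex} (ha : bdry a = ∅) : p a := by
  obtain ⟨A, hA⟩ : ∃ A : ℤ, ∀ v ∈ a, A ≤ v.1 := by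
    obtain ⟨A, hA⟩ := (a.image Prod.fst).bddBelow
    exact ⟨A, fun v hv => hA (Finset.mem_coe.2 (Finset.mem_image_of_mem _ hv))⟩
  obtain ⟨C, hC⟩ : ∃ C : ℤ, ∀ v ∈ a, C ≤ v.2 := by
    obtain ⟨A, hA⟩ := (a.image Prod.snd).bddBelow
    exact ⟨A, fun v hv => hA (Finset.mem_coe.2 (Finset.mem_image_of_mem _ hv))⟩
  obtain ⟨D, hD⟩ : ∃ D : ℤ, ∀ v ∈ a, v.2 ≤ D := by
    obtain ⟨A, hA⟩ := (a.image Prod.snd).bddAbove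
    exact ⟨A, fun v hv => hA (Finset.mem_coe.2 (Finset.mem_image_of_mem _ hv))⟩
  -- Descent on a bounding box with fixed left side `A` and bottom `C`: `n` bounds the number of
  -- rows and, inside, `m` the length of the top row. The rightmost vertex of the top row is cleared
  -- by adding a brick that does not leave the box.
  have main : ∀ n : ℕ, ∀ a : Finset Vertex, bdry a = ∅ → (∀ v ∈ a, A ≤ v.1) → (∀ v ∈ a, C ≤ v.2) →
      (∀ v ∈ a, v.2 < C + n) → p a := by
    intro n
    induction n with
    | zero =>
      intro a _ _ hC hD
      rcases a.eq_empty_or_nonempty with rfl | ⟨v, hv⟩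
      · exact h0
      · have := hC v hv; have := hD v hv; push_cast at *; omega
    | succ n ihn =>
      suffices ∀ m : ℕ, ∀ a : Finset Vertex, bdry a = ∅ → (∀ v ∈ a, A ≤ v.1) →
          (∀ v ∈ a, C ≤ v.2) → (∀ v ∈ a, v.2 < C + n + 1) →
          (∀ v ∈ a, v.2 = C + n → v.1 < A + m) → p a by
        intro a ha hA hC hD
        obtain ⟨B, hB⟩ := (a.image Prod.fst).bddAbove
        refine this (B + 1 - A).toNat a ha hA hC (fun v hv => by
          have := hD v hv; push_cast at this; omega) fun v hv _ => ?_
        have := hB (Finset.mem_coe.2 (Finset.mem_image_of_mem _ hv))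
        omega
      intro m
      induction m with
      | zero =>
        intro a ha hA hC hD hx
        refine ihn a ha hA hC fun v hv => ?_
        have := hA v hv
        have := hD v hv
        have := hx v hv
        push_cast at this
        omega
      | succ m ihm =>
        intro a ha hA hC hD hx
        by_cases hv : ((A + m, C + n) : Vertex) ∈ a
        swap
        · refine ihm a ha hA hC hD fun v hva hvy => ?_
          have h1 := hx v hva hvy
          push_cast at h1
          have h2 : v.1 ≠ A + m := by
            rintro h
            exact hv (by rwa [← h, ← hvy])
          omega
        have hz : ∀ x y : ℤ, (x < A ∨ y < C ∨ C + n < y ∨ (y = C + n ∧ A + m < x)) →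
            ((x, y) : Vertex) ∉ a := by
          intro x y h hxy
          have h1 := hA _ hxy
          have h2 := hC _ hxy
          have h3 := hD _ hxy
          have h4 := hx _ hxy
          push_cast at h4
          simp only at h1 h2 h3 h4
          omega
        have hz' : ∀ x, ((x, C + n + 1) : Vertex) ∉ a := fun x => hz _ _ (by omega)
        have hev : ∀ f : Face, pair a (bd f) = 0 := fun f => by
          rw [← pair_bdry, ha, pair_empty_left]
        -- If the corner vertex were the lower left corner of a brick, this brick would meet `a` in
        -- that vertex alone.
        rcases Int.even_or_odd (A + m + (C + n)) with hpar | hpar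
        swap
        · have := hev ⟨(A + m, C + n), hpar⟩
          rw [pair_bd] at this
          simp only [if_pos hv, if_neg (hz (A + m + 1) (C + n) (by omega)),
            if_neg (hz (A + m + 2) (C + n) (by omega)), hz', if_false] at this
          simp at this
        rw [Int.even_iff] at hpar
        -- The brick whose lower edge is centered at the corner vertex can meet `a` only there and
        -- at the left neighbor, so evenness forces the neighbor into `a`.
        have h1 : ((A + m - 1, C + n) : Vertex) ∈ a := by
          by_contra hcon
          have := hev ⟨(A + m - 1, C + n), by rw [Int.odd_iff]; simp only; omega⟩
          rw [pair_bd] at this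
          simp only [sub_add_cancel, if_pos hv, if_neg hcon,
            if_neg (hz (A + m - 1 + 2) (C + n) (by omega)),
            hz', if_false] at this
          simp at this
        -- Otherwise the brick with lower right corner at the left neighbor meets `a` only in that
        -- neighbor; for `h3`, the brick with the corner vertex as upper left corner meets `a` only
        -- in the corner vertex.
        have h2 : A ≤ A + m - 2 := by
          have := hA _ h1
          simp only at this
          by_contra hcon
          have := hev ⟨(A + m - 3, C + n), by rw [Int.odd_iff]; simp only; omega⟩
          rw [pair_bd] at this
          simp only [show A + m - 3 + 2 = A + m - 1 by ring, if_pos h1,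
            if_neg (hz (A + m - 3) (C + n) (by omega)),
            if_neg (hz (A + m - 3 + 1) (C + n) (by omega)),
            hz', if_false] at this
          simp at this
        have h3 : C ≤ C + n - 1 := by
          by_contra hcon
          have := hev ⟨(A + m, C + n - 1), by rw [Int.odd_iff]; simp only; omega⟩
          rw [pair_bd] at this
          have hz'' : ∀ x, ((x, C + n - 1) : Vertex) ∉ a := fun x => hz _ _ (by omega)
          simp only [sub_add_cancel, if_pos hv, hz'', if_false,
            if_neg (hz (A + m + 1) (C + n) (by omega)),
            if_neg (hz (A + m + 2) (C + n) (by omega))] at this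
          simp at this
        -- The brick whose upper right corner is the vertex to be removed; `h2` and `h3` say that it
        -- lies inside the box.
        let f : Face := ⟨(A + m - 2, C + n - 1), by rw [Int.odd_iff]; simp only; omega⟩
        have hf : ∀ v, v ∈ bd f ↔ A + m - 2 ≤ v.1 ∧ v.1 ≤ A + m ∧ C + n - 1 ≤ v.2 ∧
            v.2 ≤ C + n := by
          intro v
          rw [mem_bd]
          simp only [f]
          omega
        have hor : ∀ v ∈ symmDiff a (bd f), v ∈ a ∨ v ∈ bd f := fun v hv => by
          rw [Finset.mem_symmDiff] at hv
          tauto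
        have := hs (symmDiff a (bd f)) f (ihm _ ?_ ?_ ?_ ?_ ?_)
        · rwa [symmDiff_symmDiff_cancel_right] at this
        · rw [bdry_symmDiff, ha, bdry_bd, symmDiff_self]; rfl
        · intro v hv
          rcases hor v hv with h | h
          · exact hA v h
          · rw [hf] at h; omega
        · intro v hv
          rcases hor v hv with h | h
          · exact hC v h
          · rw [hf] at h; omega
        · intro v hv
          rcases hor v hv with h | h
          · exact hD v h
          · rw [hf] at h; omega
        · intro v hv' hvy
          have hne : v.1 ≠ A + m := by
            intro h
            have : v = (A + m, C + n) := Prod.ext h hvy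
            subst this
            rw [Finset.mem_symmDiff, hf] at hv'
            simp only at hv'
            rcases hv' with h | h
            · exact h.2 ⟨by omega, by omega, by omega, by omega⟩
            · exact h.2 hv
          rcases hor v hv' with h | h
          · have := hx v h hvy
            push_cast at this
            omega
          · rw [hf] at h; omega
  refine main (D + 1 - C).toNat a ha hA hC fun v hv => ?_
  have := hD v hv
  omega

/-! ### Colors and strings -/

theorem color_eq_iff {f g : Face} : f.color = g.color ↔ f.1.1 % 3 = g.1.1 % 3 := by
  simp only [Face.color]
  split_ifs <;> simp <;> omega

theorem adj_iff {v w : Vertex} : lattice.Adj v w ↔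
    (w.2 = v.2 ∧ (w.1 = v.1 + 1 ∨ v.1 = w.1 + 1)) ∨
    (w.1 = v.1 ∧ ((w.2 = v.2 + 1 ∧ (v.1 + v.2) % 2 = 1) ∨ (v.2 = w.2 + 1 ∧ (v.1 + v.2) % 2 = 0))) := by
  obtain ⟨x, y⟩ := v
  obtain ⟨x', y'⟩ := w
  simp only [lattice, SimpleGraph.fromRel_adj, Prod.ext_iff, Int.odd_iff, ne_eq]
  omega

/-- The three bricks at a vertex have lower left corners with consecutive first coordinates, hence
three different colors. -/
theorem eq_of_mem_bd {v : Vertex} {f g : Face} (hf : v ∈ bd f) (hg : v ∈ bd g)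
    (hc : f.color = g.color) : f = g := by
  rw [color_eq_iff] at hc
  rw [mem_bd] at hf hg
  have hf' := Int.odd_iff.1 f.2
  have hg' := Int.odd_iff.1 g.2
  refine Subtype.ext (Prod.ext ?_ ?_) <;> omega

/-- An edge is shared by two faces, and each of its ends touches one further face. Here the further
faces are `f` and `f'`, so the remaining faces at `u` contain the whole edge. -/
theorem mem_bd_of_adj {u w : Vertex} {f f' g : Face} (hadj : lattice.Adj u w) (hu : u ∈ bd f)
    (hw : w ∈ bd f') (hc : f.color = f'.color) (hne : f ≠ f') (hg : g.color ≠ f.color)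
    (hug : u ∈ bd g) : w ∈ bd g := by
  have hwf : w ∉ bd f := fun h => hne (eq_of_mem_bd h hw hc)
  have huf : u ∉ bd f' := fun h => hne (eq_of_mem_bd hu h hc)
  rw [Ne, color_eq_iff] at hg
  rw [color_eq_iff] at hc
  rw [mem_bd] at *
  have hf' := Int.odd_iff.1 f.2
  have hg' := Int.odd_iff.1 g.2
  have hf'' := Int.odd_iff.1 f'.2
  obtain ⟨x, y⟩ := u
  obtain ⟨x', y'⟩ := w
  rw [adj_iff] at hadj
  simp only at *
  clear hne
  rcases hadj with ⟨rfl, rfl | rfl⟩ | ⟨rfl, ⟨rfl, h⟩ | ⟨rfl, h⟩⟩ <;> omega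

/-- An edge of color `c` carries an excitation from one face of color `c` to another. -/
theorem bdry_edge {u w : Vertex} {f f' : Face} (hadj : lattice.Adj u w) (hu : u ∈ bd f)
    (hw : w ∈ bd f') (hc : f.color = f'.color) (hne : f ≠ f') :
    bdry {u, w} = symmDiff {f} {f'} := by
  have h2 : ({u, w} : Finset Vertex) = symmDiff {u} {w} :=
    insert_eq_symmDiff (by simpa using hadj.ne)
  refine finset_ext_pair fun g => ?_
  simp only [pair_bdry, h2, pair_symmDiff_left, pair_singleton_left, Finset.mem_singleton]
  -- A face of the color of the string sees at most one end of the edge, namely when it is `f` or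
  -- `f'`; a face of another color sees both ends or none, which cancels modulo two.
  by_cases hg : g.color = f.color
  · have h1 : u ∈ bd g ↔ f = g := ⟨fun h => eq_of_mem_bd hu h hg.symm, by rintro rfl; exact hu⟩
    have h2 : w ∈ bd g ↔ f' = g :=
      ⟨fun h => eq_of_mem_bd hw h (hc.symm.trans hg.symm), by rintro rfl; exact hw⟩
    simp only [h1, h2]
  · have h1 : u ∈ bd g ↔ w ∈ bd g :=
      ⟨mem_bd_of_adj hadj hu hw hc hne hg,
        mem_bd_of_adj hadj.symm hw hu hc.symm hne.symm (hc ▸ hg)⟩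
    have h3 : f ≠ g := by rintro rfl; exact hg rfl
    have h4 : f' ≠ g := by rintro rfl; exact hg hc.symm
    simp only [h1, h3, h4, if_false]
    exact CharTwo.add_self_eq_zero _

/-- This is the fusion rule that one excitation of each color is trivial. One vertex suffices,
because strings transport excitations everywhere. -/
theorem bdry_singleton_zero : bdry {(0, 0)} =
    {⟨(0, -1), by decide⟩, ⟨(-2, -1), by decide⟩, ⟨(-1, 0), by decide⟩} := by
  refine finset_ext_pair fun g => ?_
  rw [pair_bdry, pair_singleton_left, pair_singleton_right]
  congr 1
  obtain ⟨⟨p, q⟩, hg⟩ := g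
  simp only [Int.odd_iff] at hg
  simp only [mem_bd, Finset.mem_insert, Finset.mem_singleton, Subtype.mk.injEq, Prod.mk.injEq,
    eq_iff_iff]
  omega

/-- Two sets of faces whose difference is the boundary of a finite set of vertices. -/
def Homologous (e e' : Finset Face) : Prop := ∃ a, bdry a = symmDiff e e'

theorem Homologous.refl (e : Finset Face) : Homologous e e := ⟨∅, by simp⟩

theorem Homologous.symm {e e' : Finset Face} (h : Homologous e e') : Homologous e' e := by
  obtain ⟨a, ha⟩ := h
  exact ⟨a, by rw [ha, symmDiff_comm]⟩

theorem Homologous.symmDiff {e₁ e₁' e₂ e₂' : Finset Face} (h₁ : Homologous e₁ e₁')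
    (h₂ : Homologous e₂ e₂') : Homologous (symmDiff e₁ e₂) (symmDiff e₁' e₂') := by
  obtain ⟨a, ha⟩ := h₁
  obtain ⟨b, hb⟩ := h₂
  exact ⟨_root_.symmDiff a b, by rw [bdry_symmDiff, ha, hb, symmDiff_symmDiff_symmDiff_comm]⟩

theorem Homologous.trans {e₁ e₂ e₃ : Finset Face} (h₁ : Homologous e₁ e₂)
    (h₂ : Homologous e₂ e₃) : Homologous e₁ e₃ := by
  obtain ⟨a, ha⟩ := h₁
  obtain ⟨b, hb⟩ := h₂
  exact ⟨_root_.symmDiff a b, by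
    rw [bdry_symmDiff, ha, hb, symmDiff_assoc, symmDiff_symmDiff_cancel_left]⟩

theorem homologous_up {f g : Face} (hx : g.1.1 = f.1.1) (hy : g.1.2 = f.1.2 + 2) :
    Homologous {f} {g} := by
  have hf := Int.odd_iff.1 f.2
  refine ⟨{(f.1.1 + 1, f.1.2 + 1), (f.1.1 + 1, f.1.2 + 2)}, bdry_edge (f := f) (f' := g) ?_ ?_ ?_ ?_ ?_⟩
  · exact adj_iff.2 (Or.inr ⟨rfl, Or.inl ⟨by simp only; ring, by simp only; omega⟩⟩)
  · rw [mem_bd]; simp only; omega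
  · rw [mem_bd]; simp only; omega
  · rw [color_eq_iff, hx]
  · rintro rfl; omega

theorem homologous_diag {f g : Face} (hx : g.1.1 = f.1.1 + 3) (hy : g.1.2 = f.1.2 + 1) :
    Homologous {f} {g} := by
  refine ⟨{(f.1.1 + 2, f.1.2 + 1), (f.1.1 + 3, f.1.2 + 1)}, bdry_edge (f := f) (f' := g) ?_ ?_ ?_ ?_ ?_⟩
  · exact adj_iff.2 (Or.inl ⟨rfl, Or.inl (by simp only; ring)⟩)
  · rw [mem_bd]; simp only; omega
  · rw [mem_bd]; simp only; omega
  · rw [color_eq_iff]; omega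
  · rintro rfl; omega

/-- The translations by `(0, 2)` and `(3, 1)` generate all displacements between bricks of one
color. Each of them is realized by a single edge, so paths of such edges connect any two of these
bricks. -/
theorem homologous_of_color_eq {f g : Face} (h : f.color = g.color) : Homologous {f} {g} := by
  have hup : ∀ (n : ℕ) (f g : Face), g.1.1 = f.1.1 → g.1.2 = f.1.2 + 2 * n →
      Homologous {f} {g} := by
    intro n
    induction n with
    | zero =>
      intro f g hx hy
      obtain rfl : g = f := Subtype.ext (Prod.ext hx (by simpa using hy))
      exact Homologous.refl _
    | succ n ih =>
      intro f g hx hy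
      have hf := Int.odd_iff.1 f.2
      refine (ih f ⟨(f.1.1, f.1.2 + 2 * n), ?_⟩ rfl rfl).trans (homologous_up hx ?_)
      · rw [Int.odd_iff]; simp only; omega
      · simp only; push_cast at hy; omega
  have hdiag : ∀ (n : ℕ) (f g : Face), g.1.1 = f.1.1 + 3 * n → g.1.2 = f.1.2 + n →
      Homologous {f} {g} := by
    intro n
    induction n with
    | zero =>
      intro f g hx hy
      obtain rfl : g = f := Subtype.ext (Prod.ext (by simpa using hx) (by simpa using hy))
      exact Homologous.refl _
    | succ n ih =>
      intro f g hx hy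
      have hf := Int.odd_iff.1 f.2
      refine (ih f ⟨(f.1.1 + 3 * n, f.1.2 + n), ?_⟩ rfl rfl).trans (homologous_diag ?_ ?_)
      · rw [Int.odd_iff]; simp only; omega
      · simp only; push_cast at hx; omega
      · simp only; push_cast at hy; omega
  have hv : ∀ {f g : Face}, f.1.1 = g.1.1 → Homologous {f} {g} := by
    intro f g hfg
    have hf := Int.odd_iff.1 f.2
    have hg := Int.odd_iff.1 g.2
    rcases le_total f.1.2 g.1.2 with h | h
    · exact hup ((g.1.2 - f.1.2) / 2).toNat f g hfg.symm (by omega)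
    · exact (hup ((f.1.2 - g.1.2) / 2).toNat g f hfg (by omega)).symm
  have hd : ∀ {f g : Face}, f.1.1 % 3 = g.1.1 % 3 → f.1.1 ≤ g.1.1 → Homologous {f} {g} := by
    intro f g hm hx
    have hf := Int.odd_iff.1 f.2
    let n : ℕ := ((g.1.1 - f.1.1) / 3).toNat
    have hn : g.1.1 = f.1.1 + 3 * n := by omega
    refine (hdiag n f ⟨(f.1.1 + 3 * n, f.1.2 + n), ?_⟩ rfl rfl).trans (hv hn.symm)
    rw [Int.odd_iff]; simp only; omega
  rw [color_eq_iff] at h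
  rcases le_total f.1.1 g.1.1 with h' | h'
  · exact hd h h'
  · exact (hd h.symm h').symm

/-! ### Charges -/

theorem sum_symmDiff {α : Type*} [DecidableEq α] (q : α → ZMod 2) (a b : Finset α) :
    ∑ f ∈ symmDiff a b, q f = ∑ f ∈ a, q f + ∑ f ∈ b, q f := by
  have h : ∀ a b : Finset α, ∑ f ∈ a, q f = ∑ f ∈ a \ b, q f + ∑ f ∈ a ∩ b, q f := fun a b => by
    rw [← Finset.sum_union (Finset.disjoint_sdiff_inter a b), Finset.sdiff_union_inter]
  rw [h a b, h b a, Finset.inter_comm b a, symmDiff_def, Finset.sup_eq_union,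
    Finset.sum_union (disjoint_sdiff_sdiff)]
  have : ∀ p q r : ZMod 2, p + q = p + r + (q + r) := by decide
  exact this _ _ _

/-- The charge of a finite set of excitations that is detected by loops of color `c`: the parity
of the number of excitations of the other two colors. -/
def charge (e : Finset Face) (c : Color) : ZMod 2 := ∑ f ∈ e, if f.color = c then 0 else 1

theorem charge_symmDiff (e e' : Finset Face) :
    charge (symmDiff e e') = charge e + charge e' := by
  ext c
  exact sum_symmDiff _ _ _

@[simp] theorem charge_empty : charge ∅ = 0 := by
  ext c
  simp [charge]

theorem charge_singleton (f : Face) (c : Color) :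
    charge {f} c = if f.color = c then 0 else 1 := by
  simp [charge]

/-- The faces in a finite set, modulo boundaries, are determined by the numbers of faces of
the three colors. -/
theorem homologous_of_charge_eq {e e' : Finset Face} (h : charge e = charge e') :
    Homologous e e' := by
  -- One face of each color, chosen around the vertex `(0, 0)` so that together they form its
  -- boundary.
  let R : Face := ⟨(0, -1), by decide⟩
  let G : Face := ⟨(-2, -1), by decide⟩
  let B : Face := ⟨(-1, 0), by decide⟩
  let num (c : Color) (e : Finset Face) : ZMod 2 := ∑ f ∈ e, if f.color = c then 1 else 0
  let part (z : ZMod 2) (f : Face) : Finset Face := if z = 0 then ∅ else {f}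
  have part_add : ∀ y z f, part (y + z) f = symmDiff (part y f) (part z f) := by
    intro y z f
    rcases zmod_two_cases y with rfl | rfl <;> rcases zmod_two_cases z with rfl | rfl <;>
      simp [part, show (1 : ZMod 2) + 1 = 0 from rfl, ← Finset.bot_eq_empty]
  have num_add : ∀ c a b, num c (symmDiff a b) = num c a + num c b := fun c a b =>
    sum_symmDiff _ _ _
  have hcharge : ∀ e, charge e .r = num .g e + num .b e ∧ charge e .g = num .r e + num .b e := by
    intro e
    simp only [charge, num, ← Finset.sum_add_distrib]
    constructor <;> refine Finset.sum_congr rfl fun f _ => ?_ <;> cases f.color <;> simp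
  -- Normal form: all faces are moved to the representative of their color, where only the parity of
  -- their number survives.
  have key : ∀ e : Finset Face, Homologous e
      (symmDiff (symmDiff (part (num .r e) R) (part (num .g e) G)) (part (num .b e) B)) := by
    intro e
    induction e using Finset.induction_on with
    | empty => simpa [num, part] using Homologous.refl _
    | insert f e hf ih =>
      have h1 : insert f e = symmDiff {f} e := insert_eq_symmDiff hf
      have h2 : Homologous {f}
          (symmDiff (symmDiff (part (num .r {f}) R) (part (num .g {f}) G))
            (part (num .b {f}) B)) := by
        have hR : R.color = .r := by decide
        have hG : G.color = .g := by decide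
        have hB : B.color = .b := by decide
        have hnum : ∀ c, num c {f} = if f.color = c then 1 else 0 := fun c =>
          Finset.sum_singleton _ _
        rw [hnum, hnum, hnum]
        rcases hc : f.color
        · simpa [part, ← Finset.bot_eq_empty] using homologous_of_color_eq (hc.trans hR.symm)
        · simpa [part, ← Finset.bot_eq_empty] using homologous_of_color_eq (hc.trans hG.symm)
        · simpa [part, ← Finset.bot_eq_empty] using homologous_of_color_eq (hc.trans hB.symm)
      rw [h1]
      have h3 := h2.symmDiff ih
      rw [symmDiff_symmDiff_symmDiff_comm, symmDiff_symmDiff_symmDiff_comm (part _ R), ← part_add,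
        ← part_add, ← part_add, ← num_add, ← num_add, ← num_add] at h3
      exact h3
  have hzero : charge (symmDiff e e') = 0 := by
    rw [charge_symmDiff, h]
    ext c
    exact CharTwo.add_self_eq_zero _
  obtain ⟨a, ha⟩ := key (symmDiff e e')
  have hr := (hcharge (symmDiff e e')).1
  have hg := (hcharge (symmDiff e e')).2
  rw [hzero] at hr hg
  generalize num .r (symmDiff e e') = nr at *
  generalize num .g (symmDiff e e') = ng at *
  generalize num .b (symmDiff e e') = nb at *
  -- Vanishing charge makes the three parities equal. If they are all `1`, the leftover triple is
  -- removed by the vertex `(0, 0)`.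
  have hrg : nr = nb ∧ ng = nb := by
    simp only [Pi.zero_apply] at hr hg
    clear ha
    revert hr hg; revert nr ng nb; decide
  obtain ⟨rfl, rfl⟩ := hrg
  rcases zmod_two_cases ng with rfl | rfl
  · refine ⟨a, ?_⟩
    rw [ha]
    simp [part, ← Finset.bot_eq_empty]
  · refine ⟨symmDiff a {(0, 0)}, ?_⟩
    have hRGB : symmDiff (symmDiff (part 1 R) (part 1 G)) (part 1 B) = bdry {(0, 0)} := by
      rw [bdry_singleton_zero]
      simp only [part, one_ne_zero, if_false]
      decide
    rw [bdry_symmDiff, ha, hRGB, symmDiff_symmDiff_cancel_right]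

/-! ### Check operators and syndromes -/

/-- The stabilizer at the face `f` that detects excitations created by operators of type `k`. -/
def chk (k : Bool) (f : Face) : Obs := op (!k) (bd f)

@[simp] theorem chk_star (k : Bool) (f : Face) : star (chk k f) = chk k f := op_star _ _

theorem chk_mul_self (k : Bool) (f : Face) : chk k f * chk k f = 1 := op_mul_self _ _

theorem chk_comm (k k' : Bool) (f g : Face) : chk k f * chk k' g = chk k' g * chk k f := by
  by_cases h : k' = k
  · subst h
    exact op_commute _ _ _
  · obtain rfl : k' = !k := by revert h; cases k <;> cases k' <;> simp
    rw [chk, chk, op_mul_op_not, pair_bd_bd, sgn_zero, one_smul]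

theorem chk_mul_op_same (k : Bool) (f : Face) (a : Finset Vertex) :
    chk k f * op k a = sgn (pair (bdry a) {f}) • (op k a * chk k f) := by
  rw [pair_bdry, chk, op_mul_op_not, smul_smul, sgn_mul_self, one_smul]

theorem chk_not_mul_op (k : Bool) (f : Face) (a : Finset Vertex) :
    chk (!k) f * op k a = op k a * chk (!k) f := by
  rw [chk, Bool.not_not]
  exact op_commute _ _ _

/-- `ω` is a state for which the set of excitations of type `k` is `e k`. -/
structure HasSyndrome (ω : PosFunctional) (e : Bool → Finset Face) : Prop where
  map_one : ω 1 = 1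
  map_chk : ∀ k f, ω (chk k f) = sgn (pair (e k) {f})

theorem map_star_mul_self_nonneg (ω : PosFunctional) (a : Obs) : 0 ≤ ω (star a * a) :=
  ω.map_nonneg (star_mul_self_nonneg a)

/-- Cauchy–Schwarz for the form `ω (a* b)`: the vector of `b` is null. -/
theorem map_mul_eq_zero (ω : PosFunctional) {b : Obs} (hb : ω (star b * b) = 0) (a : Obs) :
    ω (a * b) = 0 := by
  have h1 : ‖ω.toPreGNS b‖ = 0 := by
    have := ω.preGNS_norm_sq (ω.toPreGNS b)
    rw [ω.ofPreGNS_toPreGNS, hb] at this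
    exact_mod_cast pow_eq_zero_iff two_ne_zero |>.1 (by exact_mod_cast this)
  have h2 := norm_inner_le_norm (𝕜 := ℂ) (ω.toPreGNS (star a)) (ω.toPreGNS b)
  rw [ω.preGNS_inner_def, h1, mul_zero, ω.ofPreGNS_toPreGNS, ω.ofPreGNS_toPreGNS, star_star] at h2
  exact norm_le_zero_iff.1 h2

@[simp] theorem conj_sgn (z : ZMod 2) : conj (sgn z) = sgn z := by
  rcases zmod_two_cases z with rfl | rfl <;> simp

@[simp] theorem star_sgn (z : ZMod 2) : star (sgn z) = sgn z := conj_sgn z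

/-- A symmetry with a sharp value can be replaced by that value. -/
theorem map_mul_symmetry {ω : PosFunctional} (h1 : ω 1 = 1) {S : Obs} (hs : star S = S)
    (hS : S * S = 1) {z : ZMod 2} (hz : ω S = sgn z) (a : Obs) : ω (a * S) = sgn z * ω a := by
  -- The vector of `S - sgn z` is null: since `S² = 1`, its squared norm is `1 - (sgn z)² = 0`.
  have h : ω (a * (S - sgn z • 1)) = 0 := by
    apply map_mul_eq_zero
    simp only [star_sub, star_smul, hs, star_one, star_sgn, mul_sub, sub_mul, hS, smul_mul_assoc,
      mul_smul_comm, one_mul, mul_one, map_sub, map_smul, h1, hz, smul_eq_mul, sgn_mul_self,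
      sub_self, mul_zero]
  rw [mul_sub, mul_smul_comm, mul_one, map_sub, map_smul, smul_eq_mul, sub_eq_zero] at h
  exact h

theorem symmetry_map_mul {ω : PosFunctional} (h1 : ω 1 = 1) {S : Obs} (hs : star S = S)
    (hS : S * S = 1) {z : ZMod 2} (hz : ω S = sgn z) (a : Obs) : ω (S * a) = sgn z * ω a := by
  have h := congrArg star (map_mul_symmetry h1 hs hS hz (star a))
  rw [← map_star, star_mul, star_star, hs, star_mul', ← map_star, star_star, star_sgn] at h
  exact h

namespace HasSyndrome

variable {ω ω' : PosFunctional} {e : Bool → Finset Face}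

theorem map_mul_chk (h : HasSyndrome ω e) (k f) (a : Obs) :
    ω (a * chk k f) = sgn (pair (e k) {f}) * ω a :=
  map_mul_symmetry h.map_one (chk_star k f) (chk_mul_self k f) (h.map_chk k f) a

theorem map_chk_mul (h : HasSyndrome ω e) (k f) (a : Obs) :
    ω (chk k f * a) = sgn (pair (e k) {f}) * ω a :=
  symmetry_map_mul h.map_one (chk_star k f) (chk_mul_self k f) (h.map_chk k f) a

/-- By `cycle_induction` the operator is a product of checks of the opposite type, and each of them
acts as its sharp sign. The constant is chosen before `ω`, so it is common to all states with the
syndrome `e`; the factor `B` allows the two Pauli types to be evaluated one after the other. -/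
theorem exists_map_op_mul {a : Finset Vertex} (ha : bdry a = ∅) (e : Bool → Finset Face)
    (k : Bool) : ∃ c : ℂ, ∀ ω, HasSyndrome ω e → ∀ B, ω (op k a * B) = c * ω B := by
  refine cycle_induction (p := fun a => ∃ c : ℂ, ∀ ω, HasSyndrome ω e → ∀ B,
    ω (op k a * B) = c * ω B) ⟨1, by simp⟩ ?_ ha
  rintro a f ⟨c, hc⟩
  refine ⟨c * sgn (pair (e (!k)) {f}), fun ω h B => ?_⟩
  have := h.map_chk_mul (!k) f B
  rw [chk, Bool.not_not] at this
  rw [← op_mul, mul_assoc, hc ω h, this, mul_assoc]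

/-- The two outer checks contribute the same sign, whose square is one, so conjugation by a check
does not change the expectation. -/
theorem map_eq_zero (h : HasSyndrome ω e) {k : Bool} {f : Face} {P : Obs}
    (hP : chk k f * P * chk k f = -P) : ω P = 0 := by
  have h1 : ω (chk k f * P * chk k f) = ω P := by
    rw [h.map_mul_chk, h.map_chk_mul, ← mul_assoc, sgn_mul_self, one_mul]
  rw [hP, map_neg] at h1
  exact self_eq_neg.1 h1.symm

/-- A face in the boundary of one factor supplies a check that anticommutes with this factor; the
check is of the same kind as the other factor and commutes with it. -/
theorem map_pauli_eq_zero (h : HasSyndrome ω e) {a b : Finset Vertex}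
    (hab : bdry a ≠ ∅ ∨ bdry b ≠ ∅) : ω (op false a * op true b) = 0 := by
  have key : ∀ {a : Finset Vertex} {k : Bool}, bdry a ≠ ∅ →
      ∃ f, chk k f * op k a = - (op k a * chk k f) := by
    intro a k ha
    obtain ⟨f, hf⟩ := Finset.nonempty_iff_ne_empty.2 ha
    refine ⟨f, ?_⟩
    rw [chk_mul_op_same, pair_singleton_right, if_pos hf, sgn_one, neg_smul, one_smul]
  rcases hab with ha | hb
  · obtain ⟨f, hf⟩ := key (k := false) ha
    apply h.map_eq_zero (k := false) (f := f)
    have h2 : chk false f * op true b = op true b * chk false f := op_commute _ _ _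
    rw [← mul_assoc, hf, neg_mul, neg_mul, mul_assoc (op false a), h2, mul_assoc, mul_assoc,
      chk_mul_self, mul_one]
  · obtain ⟨f, hf⟩ := key (k := true) hb
    apply h.map_eq_zero (k := true) (f := f)
    have h2 : chk true f * op false a = op false a * chk true f := op_commute _ _ _
    rw [← mul_assoc, h2, mul_assoc (op false a), hf, mul_neg, neg_mul, mul_assoc, mul_assoc,
      chk_mul_self, mul_one]

/-- A state with sharp values of all stabilizers is determined by these values. -/
theorem unique (h : HasSyndrome ω e) (h' : HasSyndrome ω' e) : ω = ω' := by
  refine posFunctional_ext fun a b => ?_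
  by_cases hab : bdry a ≠ ∅ ∨ bdry b ≠ ∅
  · rw [h.map_pauli_eq_zero hab, h'.map_pauli_eq_zero hab]
  · push Not at hab
    obtain ⟨c, hc⟩ := exists_map_op_mul hab.1 e false
    obtain ⟨d, hd⟩ := exists_map_op_mul hab.2 e true
    rw [← mul_one (op true b), hc ω h, hc ω' h', hd ω h, hd ω' h', h.map_one, h'.map_one]

end HasSyndrome

/-! ### Existence of the ground state -/

/-- The functional `a ↦ ⟨ψ, a ψ⟩`. -/
def vecState (ψ : ConfigSpace) : PosFunctional :=
  PositiveLinearMap.mk₀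
    { toFun := fun a => inner ℂ ψ (Obs.toOp a ψ)
      map_add' := fun a b => by simp
      map_smul' := fun c a => by simp } (by
    intro a ha
    obtain ⟨b, rfl⟩ := CStarAlgebra.nonneg_iff_eq_star_mul_self.1 ha
    change 0 ≤ inner ℂ ψ (Obs.toOp (star b * b) ψ)
    rw [toOp_mul_apply, map_star, ContinuousLinearMap.star_eq_adjoint,
      ContinuousLinearMap.adjoint_inner_right, inner_self_eq_norm_sq_to_K, ← RCLike.ofReal_pow]
    exact RCLike.ofReal_nonneg.2 (sq_nonneg _))

theorem vecState_apply (ψ : ConfigSpace) (a : Obs) :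
    vecState ψ a = inner ℂ ψ (Obs.toOp a ψ) := rfl

theorem norm_toOp (a : Obs) : ‖Obs.toOp a‖ = ‖a‖ := rfl

theorem norm_vecState_le {ψ : ConfigSpace} (hψ : ‖ψ‖ = 1) (a : Obs) : ‖vecState ψ a‖ ≤ ‖a‖ := by
  rw [vecState_apply]
  refine (norm_inner_le_norm _ _).trans ?_
  have := (Obs.toOp a).le_opNorm ψ
  rw [norm_toOp, hψ, mul_one] at this
  rwa [hψ, one_mul]

/-- Weak limits of states along an ultrafilter. -/
theorem exists_tendsto_posFunctional {ι : Type*} (U : Ultrafilter ι) (ω : ι → PosFunctional)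
    (h : ∀ i a, ‖ω i a‖ ≤ ‖a‖) :
    ∃ φ : PosFunctional, ∀ a, Tendsto (fun i => ω i a) U (𝓝 (φ a)) := by
  have h1 : ∀ a, ∃ z, Tendsto (fun i => ω i a) U (𝓝 z) := fun a => by
    obtain ⟨z, -, hz⟩ := (isCompact_closedBall (0 : ℂ) ‖a‖).ultrafilter_le_nhds'
      (U.map fun i => ω i a) (Filter.eventually_map.2 (Filter.Eventually.of_forall fun i => by simpa using h i a))
    exact ⟨z, hz⟩
  choose φ hφ using h1
  refine ⟨PositiveLinearMap.mk₀
    { toFun := φ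
      map_add' := fun a b => tendsto_nhds_unique (hφ (a + b)) (by
        simpa only [map_add] using (hφ a).add (hφ b))
      map_smul' := fun c a => tendsto_nhds_unique (hφ (c • a)) (by
        simpa only [map_smul, RingHom.id_apply] using (hφ a).const_smul c) } ?_, hφ⟩
  intro a ha
  exact ge_of_tendsto (hφ a) (Filter.Eventually.of_forall fun i => (ω i).map_nonneg ha)

/-- The vector `|∅⟩` satisfies all `σ^z` checks, and `1 + K_f` enforces the `σ^x` check at `f`
without disturbing the others. Nonnegative coefficients prevent cancellation, so the coefficient at
`∅` stays at least `1` and the vector does not vanish. -/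
theorem exists_stabilized_vector (F : Finset Face) : ∃ ψ : ConfigSpace,
    (∀ f ∈ F, Obs.toOp (chk true f) ψ = ψ) ∧ (∀ f, Obs.toOp (chk false f) ψ = ψ) ∧
      (∀ s, 0 ≤ ψ s) ∧ 1 ≤ ψ ∅ := by
  induction F using Finset.induction_on with
  | empty =>
    have happ : ∀ s, (lp.single 2 ∅ (1 : ℂ) : ConfigSpace) s = if s = ∅ then 1 else 0 := by
      intro s
      rw [lp.single_apply, Pi.single_apply]
    refine ⟨lp.single 2 ∅ (1 : ℂ), by simp, fun f => ?_, fun s => ?_, ?_⟩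
    · ext s
      rw [chk, Bool.not_false, toOp_op_true, happ]
      split_ifs with hs <;> simp [hs]
    · rw [happ]; split_ifs <;> simp
    · rw [happ]; simp
  | insert f F hf ih =>
    obtain ⟨ψ, hK, hJ, h0, h1⟩ := ih
    have hc : ∀ k g, Obs.toOp (chk k g) ψ = ψ →
        Obs.toOp (chk k g) (ψ + Obs.toOp (chk true f) ψ) = ψ + Obs.toOp (chk true f) ψ := by
      intro k g h
      rw [map_add, ← toOp_mul_apply, chk_comm, toOp_mul_apply, h]
    have happ : ∀ s, (ψ + Obs.toOp (chk true f) ψ) s = ψ s + ψ (symmDiff s (bd f)) := by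
      intro s
      rw [chk, Bool.not_true, lp.coeFn_add, Pi.add_apply, toOp_op_false]
    refine ⟨ψ + Obs.toOp (chk true f) ψ, ?_, fun g => hc _ g (hJ g), fun s => ?_, ?_⟩
    · intro g hg
      rcases Finset.mem_insert.1 hg with rfl | hg
      · rw [map_add, ← toOp_mul_apply, chk_mul_self, map_one, add_comm]
        rfl
      · exact hc _ g (hK g hg)
    · rw [happ]; exact add_nonneg (h0 _) (h0 _)
    · rw [happ]; exact le_add_of_le_of_nonneg h1 (h0 _)

/-- Vector states satisfy any finite number of `σ^x` checks, and a weak limit along an ultrafilter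
on the finite sets of faces satisfies all of them: each check is eventually sharp. -/
theorem exists_hasSyndrome_empty : ∃ ω, HasSyndrome ω fun _ => ∅ := by
  have h : ∀ F : Finset Face, ∃ ψ : ConfigSpace, ‖ψ‖ = 1 ∧
      ∀ k, ∀ f ∈ F, Obs.toOp (chk k f) ψ = ψ := by
    intro F
    obtain ⟨ψ, hK, hJ, -, h1⟩ := exists_stabilized_vector F
    have hne : ψ ≠ 0 := by
      rintro rfl
      simp only [lp.coeFn_zero, Pi.zero_apply] at h1
      exact absurd h1 (not_le_of_gt zero_lt_one)
    refine ⟨((‖ψ‖⁻¹ : ℝ) : ℂ) • ψ, ?_, fun k f hf => ?_⟩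
    · rw [norm_smul]
      simp [hne]
    · rw [map_smul]
      cases k
      · rw [hJ]
      · rw [hK f hf]
  choose ψ hψ hs using h
  obtain ⟨φ, hφ⟩ := exists_tendsto_posFunctional (Ultrafilter.of (atTop : Filter (Finset Face)))
    (fun F => vecState (ψ F)) (fun F => norm_vecState_le (hψ F))
  refine ⟨φ, tendsto_nhds_unique (hφ 1) ?_, fun k f => tendsto_nhds_unique (hφ _) ?_⟩
  · refine tendsto_const_nhds.congr fun F => ?_
    rw [vecState_apply, map_one]
    simp [hψ]
  · refine Tendsto.mono_left ?_ (Ultrafilter.of_le _)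
    refine tendsto_const_nhds.congr' ?_
    filter_upwards [eventually_ge_atTop {f}] with F hF
    rw [vecState_apply, hs F k f (by simpa using hF)]
    simp [hψ]

/-! ### Ground states -/

theorem hamiltonian_eq (Λ : Finset Vertex) (k : Bool) : hamiltonian Λ =
    -∑ f ∈ facesMeeting Λ, (chk k f + chk (!k) f) := by
  simp only [hamiltonian, stabK_eq, stabJ_eq, chk, Finset.sum_add_distrib]
  cases k <;> simp <;> abel

/-- `1 - chk k f` is twice the projection onto the presence of an excitation. The factor two is the
energy of the excitation. -/
theorem one_sub_chk_mul_self (k f) :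
    (1 - chk k f) * (1 - chk k f) = (2 : ℂ) • (1 - chk k f) := by
  rw [mul_sub, sub_mul, sub_mul, chk_mul_self, two_smul]
  simp only [one_mul, mul_one]
  abel

theorem nonneg_of_ofReal_mul_nonneg {r : ℝ} (hr : 0 < r) {z : ℂ} (h : 0 ≤ (r : ℂ) * z) :
    0 ≤ z := by
  rw [Complex.nonneg_iff] at *
  rw [Complex.re_ofReal_mul, Complex.im_ofReal_mul, zero_eq_mul] at h
  exact ⟨nonneg_of_mul_nonneg_right h.1 hr, (h.2.resolve_left hr.ne').symm⟩

theorem map_star_mul_chk_mul_le (ω : PosFunctional) (k f) (A : Obs) :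
    ω (star A * chk k f * A) ≤ ω (star A * A) := by
  have h := map_star_mul_self_nonneg ω ((1 - chk k f) * A)
  have e : star ((1 - chk k f) * A) * ((1 - chk k f) * A) =
      (2 : ℂ) • (star A * A - star A * chk k f * A) := by
    rw [star_mul, star_sub, star_one, chk_star, mul_assoc, ← mul_assoc (1 - chk k f), one_sub_chk_mul_self,
      smul_mul_assoc, mul_smul_comm, sub_mul, mul_sub, one_mul, mul_assoc]
  rw [e, map_smul, map_sub, smul_eq_mul] at h
  exact sub_nonneg.1 (nonneg_of_ofReal_mul_nonneg two_pos (by simpa using h))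

/-- The model is frustration free. The expression equals `ω (A* H A) - ω (A* A H)`, and each term
`-chk` of `H` already has its lowest value in `ω`, so the inequality holds term by term. -/
theorem HasSyndrome.ground {ω : PosFunctional} (h : HasSyndrome ω fun _ => ∅) (Λ : Finset Vertex)
    (A : Obs) : 0 ≤ -Complex.I * ω (star A * derivation Λ A) := by
  have h1 : -Complex.I * ω (star A * derivation Λ A) =
      ω (star A * hamiltonian Λ * A) - ω (star A * A * hamiltonian Λ) := by
    rw [derivation, mul_smul_comm, map_smul, smul_eq_mul, ← mul_assoc]
    simp [mul_sub, mul_assoc]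
  have h2 : ∀ k f, ω (star A * A * chk k f) = ω (star A * A) := fun k f => by
    rw [h.map_mul_chk]; simp
  rw [h1, hamiltonian_eq Λ true]
  simp only [mul_neg, neg_mul, Finset.mul_sum, Finset.sum_mul, map_neg, map_sum, mul_add, add_mul,
    map_add, h2, sub_neg_eq_add]
  rw [neg_add_eq_sub, ← Finset.sum_sub_distrib]
  refine Finset.sum_nonneg fun f _ => sub_nonneg.2 (add_le_add ?_ ?_) <;>
  exact map_star_mul_chk_mul_le _ _ _ _

/-- The translate of a face by a translation of the lattice. -/
def Face.shift (f : Face) (t : ℤ × ℤ) (ht : Even (t.1 + t.2)) : Face :=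
  ⟨f.1 + t, by
    have := f.2.add_even ht
    rwa [Prod.fst_add, Prod.snd_add, add_add_add_comm]⟩

theorem bd_shift (f : Face) (t : ℤ × ℤ) (ht) : bd (f.shift t ht) = (bd f).image (· + t) := by
  ext v
  simp only [Finset.mem_image, mem_bd, Face.shift, Prod.fst_add, Prod.snd_add]
  constructor
  · intro h
    exact ⟨v - t, by simp only [Prod.fst_sub, Prod.snd_sub]; omega, by simp⟩
  · rintro ⟨w, hw, rfl⟩
    simp only [Prod.fst_add, Prod.snd_add]
    omega

theorem translate_op (t : ℤ × ℤ) (k : Bool) (a : Finset Vertex) :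
    translate t (op k a) = op k (a.image (· + t)) := by
  have h : translate t (op k a) = siteProd (a.toList.map (· + t)) (pauliMatrix k) := by
    rw [op, siteProd, siteProd, map_list_prod, List.map_map, List.map_map]
    congr 1
    exact List.map_congr_left fun v _ => translate_site _ _ _
  rw [h, siteProd_eq_op (a.nodup_toList.map (add_left_injective t))]
  congr 1
  ext v
  simp only [List.mem_toFinset, List.mem_map, Finset.mem_toList, Finset.mem_image]

theorem translate_chk (t : ℤ × ℤ) (ht : Even (t.1 + t.2)) (k : Bool) (f : Face) :
    translate t (chk k f) = chk k (f.shift t ht) := by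
  rw [chk, translate_op, ← bd_shift, chk]

/-- Translations permute the checks, so the translated state also has no excitations; uniqueness
gives invariance. -/
theorem HasSyndrome.isInvariantGroundState {ω : PosFunctional} (h : HasSyndrome ω fun _ => ∅) :
    IsInvariantGroundState ω where
  map_one := h.map_one
  ground Λ A _ := h.ground Λ A
  invariant t ht A := by
    have h' : HasSyndrome (pullback ω (translate t)) fun _ => ∅ :=
      ⟨by rw [pullback_apply, _root_.map_one, h.map_one],
        fun k f => by rw [pullback_apply, translate_chk t ht, h.map_chk]; simp⟩
    rw [← pullback_apply, h'.unique h]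

/-- In a ground state there is at most one excitation of each color and type. -/
theorem map_two_excitations_le {ω : PosFunctional}
    (hω : ∀ (Λ : Finset Vertex), ∀ A ∈ localAlg (Λ : Set Vertex),
      0 ≤ -Complex.I * ω (star A * derivation Λ A)) (k : Bool) {f f' : Face} (hne : f ≠ f')
    (hc : f.color = f'.color) : ω ((1 - chk k f) * (1 - chk k f')) ≤ 0 := by
  obtain ⟨a, ha⟩ := homologous_of_color_eq hc
  have ha' : bdry a = {f, f'} := by
    rw [ha, ← insert_eq_symmDiff (by simpa using hne)]
  -- The test observable will be `op k a * (1 - chk k f)`: select the configurations with an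
  -- excitation at `f`, then apply the string from `f` to `f'`. If `f'` was excited too, both
  -- excitations disappear and the energy drops; otherwise the excitation only moves, at no cost.
  -- Both factors must be supported in `Λ`.
  let Λ := a ∪ bd f
  have hsub : bdry a ⊆ facesMeeting Λ := fun g hg => by
    obtain ⟨v, hv, hva⟩ := mem_facesMeeting_iff.1 (Finset.mem_filter.1 hg).1
    exact mem_facesMeeting_iff.2 ⟨v, hv, Finset.mem_union_left _ hva⟩
  -- Only the checks at the two ends of the string anticommute with it.
  have hcomm : hamiltonian Λ * op k a - op k a * hamiltonian Λ =
      (2 : ℂ) • (op k a * (chk k f + chk k f')) := by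
    have h1 : ∀ g, chk k g * op k a - op k a * chk k g =
        if g ∈ bdry a then (-2 : ℂ) • (op k a * chk k g) else 0 := by
      intro g
      rw [chk_mul_op_same, pair_singleton_right]
      split_ifs
      · rw [sgn_one, neg_smul, neg_smul, one_smul, two_smul]; abel
      · simp
    rw [hamiltonian_eq Λ k, neg_mul, mul_neg, Finset.mul_sum, Finset.sum_mul, sub_neg_eq_add,
      neg_add_eq_sub, ← neg_sub, ← Finset.sum_sub_distrib]
    simp only [add_mul, mul_add, chk_not_mul_op, add_sub_add_right_eq_sub, h1]
    rw [← Finset.sum_filter, Finset.filter_mem_eq_inter, Finset.inter_eq_right.2 hsub, ha',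
      Finset.sum_pair hne, smul_add, neg_smul, neg_smul]
    abel
  have hP : hamiltonian Λ * (1 - chk k f) = (1 - chk k f) * hamiltonian Λ := by
    have : ∑ g ∈ facesMeeting Λ, (chk k g + chk (!k) g) * chk k f =
        ∑ g ∈ facesMeeting Λ, chk k f * (chk k g + chk (!k) g) :=
      Finset.sum_congr rfl fun g _ => by rw [add_mul, mul_add, chk_comm, chk_comm (!k)]
    rw [hamiltonian_eq Λ k, mul_sub, sub_mul, neg_mul _ (chk k f), mul_neg (chk k f),
      Finset.sum_mul, Finset.mul_sum, this, mul_one, one_mul]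
  have hmem : op k a * (1 - chk k f) ∈ localAlg (Λ : Set Vertex) :=
    mul_mem (op_mem_localAlg k (by simp [Λ])) (sub_mem (one_mem _)
      (op_mem_localAlg _ (by simp [Λ])))
  have h := hω Λ _ hmem
  -- The terms with `chk k f` and `chk k f'` combine to `chk k f' - 1`, because `chk k f` takes the
  -- value `-1` on the range of `1 - chk k f`. The ground state condition becomes `0 ≤ -4 ω ((1 -
  -- chk k f) (1 - chk k f'))`.
  have e : star (op k a * (1 - chk k f)) * derivation Λ (op k a * (1 - chk k f)) =
      (-4 * Complex.I) • ((1 - chk k f) * (1 - chk k f')) := by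
    have e1 : hamiltonian Λ * (op k a * (1 - chk k f)) - op k a * (1 - chk k f) * hamiltonian Λ =
        (2 : ℂ) • (op k a * (chk k f + chk k f')) * (1 - chk k f) := by
      rw [← hcomm, sub_mul, mul_assoc (op k a) (hamiltonian Λ), hP]
      simp only [mul_assoc]
    have e2 : chk k f * (1 - chk k f) = -(1 - chk k f) := by
      rw [mul_sub, chk_mul_self, mul_one]; abel
    have e3 : chk k f' * (1 - chk k f) = (1 - chk k f) * chk k f' := by
      rw [mul_sub, sub_mul, chk_comm, mul_one, one_mul]
    rw [derivation, e1, star_mul, op_star, star_sub, star_one, chk_star]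
    calc (1 - chk k f) * op k a * Complex.I • ((2 : ℂ) • (op k a * (chk k f + chk k f')) *
          (1 - chk k f))
        = (2 * Complex.I) • ((1 - chk k f) * (op k a * op k a) * ((chk k f + chk k f') *
          (1 - chk k f))) := by
          simp only [smul_mul_assoc, mul_smul_comm, smul_smul, mul_assoc]
          rw [mul_comm Complex.I]
      _ = (2 * Complex.I) • ((1 - chk k f) * (1 - chk k f) * (chk k f' - 1)) := by
          rw [op_mul_self, mul_one, add_mul, e2, e3, mul_assoc (1 - chk k f) (1 - chk k f),
            mul_sub (1 - chk k f) (chk k f') 1, mul_one, neg_add_eq_sub]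
      _ = _ := by
          rw [one_sub_chk_mul_self, smul_mul_assoc, smul_smul, ← neg_sub 1 (chk k f'), mul_neg, smul_neg,
            ← neg_smul]
          congr 1
          ring
  rw [e, map_smul, smul_eq_mul, ← mul_assoc] at h
  have h4 : -Complex.I * (-4 * Complex.I) = -4 := by
    ring_nf; simp
  rw [h4, neg_mul, ← mul_neg] at h
  exact neg_nonneg.1 (nonneg_of_ofReal_mul_nonneg (r := 4) (by norm_num) (by simpa using h))

/-- An excitation equally likely at infinitely many faces of one color, yet never at two of them,
has probability zero. Let `p = ω (1 - chk k f)`, and let `Y` be the sum of `N` translates of `1 -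
chk k f`. Then `ω Y = N p` and `ω (Y²) ≤ 2 N p`, so `0 ≤ ω ((2 - Y)²)` gives `N p ≤ 2` for every
`N`. -/
theorem IsInvariantGroundState.hasSyndrome {ω : PosFunctional} (hω : IsInvariantGroundState ω) :
    HasSyndrome ω fun _ => ∅ := by
  refine ⟨hω.map_one, fun k f => ?_⟩
  rw [pair_empty_left, sgn_zero]
  -- Vertical translations leave the first coordinate unchanged, hence also the color.
  have ht : ∀ n : ℕ, Even (((0, 2 * n) : ℤ × ℤ).1 + ((0, 2 * n) : ℤ × ℤ).2) := fun n => by simp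
  let g (n : ℕ) : Face := f.shift (0, 2 * n) (ht n)
  have hg : ∀ n, ω (chk k (g n)) = ω (chk k f) := fun n => by
    rw [← translate_chk, hω.invariant _ (ht n)]
  have hgc : ∀ m n, (g m).color = (g n).color := fun m n => by
    rw [color_eq_iff]; simp [g, Face.shift]
  have hgi : ∀ m n, m ≠ n → g m ≠ g n := fun m n hmn h => by
    have := congrArg (fun f : Face => f.1.2) h
    simp [g, Face.shift] at this
    exact hmn this
  have hPs : ∀ f, star (1 - chk k f) = 1 - chk k f := fun f => by simp
  have h0 : 0 ≤ ω (1 - chk k f) := by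
    have := map_star_mul_self_nonneg ω (1 - chk k f)
    rw [hPs, one_sub_chk_mul_self, map_smul, smul_eq_mul] at this
    exact nonneg_of_ofReal_mul_nonneg two_pos (by simpa using this)
  have hbound : ∀ N : ℕ, (N : ℝ) * (ω (1 - chk k f)).re ≤ 2 := by
    intro N
    let Y := ∑ n ∈ Finset.range N, (1 - chk k (g n))
    have hp : ∀ n, ω (1 - chk k (g n)) = ω (1 - chk k f) := fun n => by
      rw [map_sub, map_sub, hg]
    have hY : star Y = Y := by simp [Y]
    have hωY : ω Y = N * ω (1 - chk k f) := by
      simp only [Y, map_sum, hp, Finset.sum_const, Finset.card_range, nsmul_eq_mul]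
    -- The diagonal terms are `2 p` each; the others are nonpositive by `map_two_excitations_le`.
    have hYY : ω (Y * Y) ≤ N * (2 * ω (1 - chk k f)) := by
      simp only [Y, Finset.sum_mul_sum, map_sum]
      calc _ ≤ ∑ i ∈ Finset.range N, ∑ j ∈ Finset.range N,
            if i = j then 2 * ω (1 - chk k f) else 0 := by
            refine Finset.sum_le_sum fun i _ => Finset.sum_le_sum fun j _ => ?_
            split_ifs with hij
            · rw [hij, one_sub_chk_mul_self, map_smul, smul_eq_mul, hp]
            · exact map_two_excitations_le hω.ground k (hgi i j hij) (hgc i j)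
        _ = _ := by
            simp only [Finset.sum_ite_eq, Finset.mem_range]
            rw [Finset.sum_congr rfl fun i hi => if_pos (Finset.mem_range.1 hi)]
            simp
    have h2 := map_star_mul_self_nonneg ω ((2 : ℂ) • 1 - Y)
    have e : star ((2 : ℂ) • (1 : Obs) - Y) * ((2 : ℂ) • 1 - Y) =
        (4 : ℂ) • 1 - (4 : ℂ) • Y + Y * Y := by
      rw [star_sub, hY, star_smul, star_one]
      simp only [mul_sub, sub_mul, smul_mul_assoc, mul_smul_comm, one_mul, mul_one, smul_sub]
      rw [show star (2 : ℂ) = 2 by simp, show (4 : ℂ) = 2 + 2 by norm_num, add_smul _ _ Y,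
        smul_smul, show (2 : ℂ) * 2 = 2 + 2 by norm_num]
      abel
    rw [e, map_add, map_sub, map_smul, map_smul, hω.map_one, hωY] at h2
    have h3 := h2.trans (add_le_add_right hYY _)
    have h4 := (Complex.le_def.1 h3).1
    simp only [Complex.zero_re, smul_eq_mul, mul_one, Complex.add_re, Complex.sub_re,
      Complex.mul_re, Complex.re_ofNat, Complex.im_ofNat, Complex.natCast_re, Complex.natCast_im,
      zero_mul, sub_zero] at h4
    linarith
  have hre : (ω (1 - chk k f)).re ≤ 0 := by
    by_contra hcon
    push Not at hcon
    obtain ⟨N, hN⟩ := exists_nat_gt (2 / (ω (1 - chk k f)).re)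
    rw [div_lt_iff₀ hcon] at hN
    exact absurd (hbound N) (not_le.2 hN)
  have hz : ω (1 - chk k f) = 0 := by
    rw [Complex.le_def] at h0
    exact Complex.ext (le_antisymm hre h0.1) h0.2.symm
  rw [map_sub, hω.map_one, sub_eq_zero] at hz
  exact hz.symm

/-! ### Equivalence of GNS representations -/

/-- The extension of a linear isometry equivalence to the completions. -/
def completionIsometryEquiv {E F : Type*} [SeminormedAddCommGroup E] [NormedSpace ℂ E]
    [SeminormedAddCommGroup F] [NormedSpace ℂ F] (f : E ≃ₗᵢ[ℂ] F) :
    UniformSpace.Completion E ≃ₗᵢ[ℂ] UniformSpace.Completion F where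
  toLinearEquiv := LinearEquiv.ofLinearMap
    (f : E →L[ℂ] F).completion.toLinearMap (f.symm : F →L[ℂ] E).completion.toLinearMap
    (by
      ext x
      change (f : E →L[ℂ] F).completion ((f.symm : F →L[ℂ] E).completion x) = x
      induction x using UniformSpace.Completion.induction_on with
      | hp => apply isClosed_eq <;> fun_prop
      | ih x => simp)
    (by
      ext x
      change (f.symm : F →L[ℂ] E).completion ((f : E →L[ℂ] F).completion x) = x
      induction x using UniformSpace.Completion.induction_on with
      | hp => apply isClosed_eq <;> fun_prop
      | ih x => simp)
  norm_map' x := by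
    change ‖(f : E →L[ℂ] F).completion x‖ = ‖x‖
    induction x using UniformSpace.Completion.induction_on with
    | hp => apply isClosed_eq <;> fun_prop
    | ih x => simp

theorem completionIsometryEquiv_coe {E F : Type*} [SeminormedAddCommGroup E] [NormedSpace ℂ E]
    [SeminormedAddCommGroup F] [NormedSpace ℂ F] (f : E ≃ₗᵢ[ℂ] F) (x : E) :
    completionIsometryEquiv f x = f x :=
  ContinuousLinearMap.completion_apply_coe (f : E →L[ℂ] F) x

theorem gnsStarAlgHom_coe (ω : PosFunctional) (a : Obs) (x : ω.PreGNS) :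
    ω.gnsStarAlgHom a (x : ω.GNS) = (ω.toPreGNS (a * ω.ofPreGNS x) : ω.PreGNS) := by
  exact ω.gnsNonUnitalStarAlgHom_apply_coe

/-- `e` preserves the GNS seminorms and commutes with left multiplication by `B`, so its extension
to the completions is the intertwiner. Null vectors need no separate treatment, as the completion
identifies them with zero. -/
theorem equivOn_of_linearEquiv {B : StarSubalgebra ℂ Obs} {ω₁ ω₂ : PosFunctional}
    (e : Obs ≃ₗ[ℂ] Obs) (he : ∀ a, ω₂ (star (e a) * e a) = ω₁ (star a * a))
    (hB : ∀ a ∈ B, ∀ b, e (a * b) = a * e b) : EquivOn B ω₁ ω₂ := by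
  let f : ω₁.PreGNS ≃ₗᵢ[ℂ] ω₂.PreGNS :=
    { toLinearEquiv := ω₁.ofPreGNS.trans (e.trans ω₂.toPreGNS)
      norm_map' := fun x => by
        rw [ω₂.preGNS_norm_def, ω₁.preGNS_norm_def]
        exact congrArg (fun z : ℂ => √z.re) (he (ω₁.ofPreGNS x)) }
  have hf : ∀ x, f x = ω₂.toPreGNS (e (ω₁.ofPreGNS x)) := fun _ => rfl
  refine ⟨completionIsometryEquiv f, fun a ha ξ => ?_⟩
  induction ξ using UniformSpace.Completion.induction_on with
  | hp => apply isClosed_eq <;> fun_prop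
  | ih x =>
    rw [gnsStarAlgHom_coe, completionIsometryEquiv_coe, completionIsometryEquiv_coe,
      gnsStarAlgHom_coe, hf, hf, ω₁.ofPreGNS_toPreGNS, ω₂.ofPreGNS_toPreGNS, hB a ha]

theorem EquivOn.trans {B : StarSubalgebra ℂ Obs} {ω₁ ω₂ ω₃ : PosFunctional}
    (h : EquivOn B ω₁ ω₂) (h' : EquivOn B ω₂ ω₃) : EquivOn B ω₁ ω₃ := by
  obtain ⟨U, hU⟩ := h
  obtain ⟨V, hV⟩ := h'
  refine ⟨U.trans V, fun a ha ξ => ?_⟩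
  rw [LinearIsometryEquiv.trans_apply, LinearIsometryEquiv.trans_apply, hU a ha, hV a ha]

theorem EquivOn.mono {B B' : StarSubalgebra ℂ Obs} {ω₁ ω₂ : PosFunctional}
    (h : EquivOn B ω₁ ω₂) (hB : B' ≤ B) : EquivOn B' ω₁ ω₂ := by
  obtain ⟨U, hU⟩ := h
  exact ⟨U, fun a ha => hU a (hB ha)⟩

/-- The map `b ↦ ρ b` intertwines the action of `a` with that of `ρ a`, which is `a` itself on `B`.
Surjectivity of `ρ` makes the intertwiner unitary. -/
theorem equivOn_pullback {B : StarSubalgebra ℂ Obs} (ω : PosFunctional) {ρ : Obs →⋆ₐ[ℂ] Obs}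
    (hρ : Function.Bijective ρ) (hB : ∀ a ∈ B, ρ a = a) : EquivOn B (pullback ω ρ) ω :=
  equivOn_of_linearEquiv (LinearEquiv.ofBijective ρ.toAlgHom.toLinearMap hρ)
    (fun a => by
      change ω (star (ρ a) * ρ a) = ω (ρ (star a * a))
      rw [map_mul ρ, map_star ρ])
    (fun a ha b => by
      change ρ (a * b) = a * ρ b
      rw [map_mul, hB a ha])

/-- Right multiplication by `u` commutes with the left action of the whole algebra. -/
theorem gnsEquiv_conj {ω ω' : PosFunctional} {u : Obs} (hu : u ∈ unitary Obs)
    (h : ∀ a, ω' a = ω (star u * a * u)) : GNSEquiv ω' ω := by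
  obtain ⟨h1, h2⟩ := Unitary.mem_iff.1 hu
  let e : Obs ≃ₗ[ℂ] Obs := LinearEquiv.ofLinearMap (LinearMap.mulRight ℂ u)
    (LinearMap.mulRight ℂ (star u))
    (by ext a; simp [mul_assoc, h1]) (by ext a; simp [mul_assoc, h2])
  have he : ∀ a, e a = a * u := fun _ => rfl
  refine equivOn_of_linearEquiv e (fun a => ?_) fun a _ b => ?_
  · rw [he, star_mul, h]
    simp only [mul_assoc]
  · rw [he, he, mul_assoc]

/-! ### Inequivalence of GNS representations -/

theorem toPreGNS_norm_eq_zero {ω : PosFunctional} {a : Obs} (h : ω (star a * a) = 0) :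
    ‖(ω.toPreGNS a : ω.GNS)‖ = 0 := by
  rw [UniformSpace.Completion.norm_coe, ω.preGNS_norm_def, ω.ofPreGNS_toPreGNS, h]
  simp

theorem exists_mem_norm_sub_lt (ω : PosFunctional) {s : Set Obs} (hs : Dense s) (ξ : ω.GNS)
    {ε : ℝ} (hε : 0 < ε) : ∃ a ∈ s, ‖ξ - (ω.toPreGNS a : ω.GNS)‖ < ε := by
  obtain ⟨p, hp⟩ := Metric.denseRange_iff.1 (UniformSpace.Completion.denseRange_coe
    (α := ω.PreGNS)) ξ (ε / 2) (half_pos hε)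
  obtain ⟨b, rfl⟩ : ∃ b, ω.toPreGNS b = p := ⟨ω.ofPreGNS p, rfl⟩
  have hc : Continuous fun a => √(ω (star (b - a) * (b - a))).re := by
    have := PosFunctional.continuous ω
    fun_prop
  obtain ⟨a, ha, has⟩ := hs.exists_mem_open (isOpen_Iio.preimage hc (t := Set.Iio (ε / 2)))
    ⟨b, by simp [hε]⟩
  refine ⟨a, ha, ?_⟩
  have h2 : ‖(ω.toPreGNS b : ω.GNS) - (ω.toPreGNS a : ω.GNS)‖ < ε / 2 := by
    rw [← UniformSpace.Completion.coe_sub, ← map_sub, UniformSpace.Completion.norm_coe,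
      ω.preGNS_norm_def, ω.ofPreGNS_toPreGNS]
    exact has
  rw [dist_eq_norm] at hp
  calc _ ≤ _ := norm_sub_le_norm_sub_add_norm_sub ξ (ω.toPreGNS b : ω.GNS) _
    _ < ε / 2 + ε / 2 := add_lt_add hp h2
    _ = ε := add_halves ε

/-- States that assign different signs to a family of symmetries at infinity have inequivalent
GNS representations. -/
theorem not_gnsEquiv_of_sgn_ne {ι : Type*} {l : Filter ι} [l.NeBot] {ω ω' : PosFunctional}
    (h1 : ω 1 = 1) (h1' : ω' 1 = 1) (L : ι → Obs) (hs : ∀ i, star (L i) = L i)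
    (hL : ∀ i, L i * L i = 1) (hc : ∀ v M, ∀ᶠ i in l, L i * site v M = site v M * L i)
    {z z' : ZMod 2} (hz : ∀ᶠ i in l, ω (L i) = sgn z) (hz' : ∀ᶠ i in l, ω' (L i) = sgn z')
    (hne : z ≠ z') : ¬ GNSEquiv ω ω' := by
  rintro ⟨U, hU⟩
  -- The observables that eventually commute with `L i`. They form a dense algebra because it
  -- contains all one-qubit observables.
  let S : StarSubalgebra ℂ Obs :=
    { carrier := {a | ∀ᶠ i in l, L i * a = a * L i}
      mul_mem' := fun {a b} (ha : ∀ᶠ i in l, _) (hb : ∀ᶠ i in l, _) => by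
        filter_upwards [ha, hb] with i hi hi'
        rw [← mul_assoc, hi, mul_assoc, hi', mul_assoc]
      add_mem' := fun {a b} (ha : ∀ᶠ i in l, _) (hb : ∀ᶠ i in l, _) => by
        filter_upwards [ha, hb] with i hi hi'
        rw [mul_add, add_mul, hi, hi']
      algebraMap_mem' := fun r => Eventually.of_forall fun i => (Algebra.commutes r (L i)).symm
      star_mem' := fun {a} (ha : ∀ᶠ i in l, _) => by
        filter_upwards [ha] with i hi
        simpa [hs] using (congrArg star hi).symm }
  have hS : Dense (S : Set Obs) := fun a =>
    Obs.mem_of_isClosed S.topologicalClosure (StarSubalgebra.isClosed_topologicalClosure _)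
      (fun v M => StarSubalgebra.le_topologicalClosure _ (hc v M)) a
  let Ω : ω'.GNS := (ω'.toPreGNS 1 : ω'.PreGNS)
  have hΩ : ‖Ω‖ = 1 := by
    rw [UniformSpace.Completion.norm_coe, ω'.preGNS_norm_def, ω'.ofPreGNS_toPreGNS]
    simp [h1']
  -- If `U` exists, `ξ = U⁻¹ Ω` is approximated by the vector `η` of some `a` in `S`. For suitable
  -- `i` the operator `L i` acts as `sgn z'` on `ξ` and as `sgn z` on `η`, since it can be moved
  -- past `a`. Opposite eigenvectors of a symmetry are orthogonal, so they cannot be closer than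
  -- `1`.
  obtain ⟨a, ha, hlt⟩ := exists_mem_norm_sub_lt ω hS (U.symm Ω) one_pos
  obtain ⟨i, hai, hi, hi'⟩ := (Eventually.and (show ∀ᶠ i in l, _ from ha) (hz.and hz')).exists
  have hsharp : ∀ {ω : PosFunctional} {z : ZMod 2}, ω 1 = 1 → ω (L i) = sgn z → ∀ a,
      ω (star (a * (L i - sgn z • 1)) * (a * (L i - sgn z • 1))) = 0 := by
    intro ω z h1 hz a
    rw [← mul_assoc, mul_sub, map_sub, mul_smul_comm, mul_one,
      map_mul_symmetry h1 (hs i) (hL i) hz, map_smul, smul_eq_mul, sub_self]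
  have e1 : ω'.gnsStarAlgHom (L i) Ω = sgn z' • Ω := by
    rw [gnsStarAlgHom_coe, ω'.ofPreGNS_toPreGNS, mul_one, ← sub_eq_zero, ← norm_eq_zero,
      ← UniformSpace.Completion.coe_smul, ← UniformSpace.Completion.coe_sub, ← map_smul,
      ← map_sub]
    apply toPreGNS_norm_eq_zero
    simpa using hsharp h1' hi' 1
  have e2 : ω.gnsStarAlgHom (L i) (U.symm Ω) = sgn z' • U.symm Ω := by
    apply U.injective
    rw [hU _ trivial, U.apply_symm_apply, e1, map_smul, U.apply_symm_apply]
  let η : ω.GNS := (ω.toPreGNS a : ω.PreGNS)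
  have e3 : ω.gnsStarAlgHom (L i) η = sgn z • η := by
    rw [gnsStarAlgHom_coe, ω.ofPreGNS_toPreGNS, hai, ← sub_eq_zero, ← norm_eq_zero,
      ← UniformSpace.Completion.coe_smul, ← UniformSpace.Completion.coe_sub, ← map_smul,
      ← map_sub]
    apply toPreGNS_norm_eq_zero
    simpa [mul_sub] using hsharp h1 hi a
  have hu : L i ∈ unitary Obs := by
    rw [Unitary.mem_iff, hs]
    exact ⟨hL i, hL i⟩
  have e4 : ‖ω.gnsStarAlgHom (L i) (U.symm Ω - η)‖ = ‖U.symm Ω - η‖ :=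
    ContinuousLinearMap.norm_map_of_mem_unitary (Unitary.map_mem ω.gnsStarAlgHom hu) _
  have hz2 : ‖sgn z'‖ = 1 ∧ ‖sgn z‖ = 1 ∧ ‖sgn z' - sgn z‖ = 2 := by
    rcases zmod_two_cases z with rfl | rfl <;> rcases zmod_two_cases z' with rfl | rfl
    · exact absurd rfl hne
    · norm_num
    · norm_num
    · exact absurd rfl hne
  rw [map_sub, e2, e3] at e4
  -- The left side has norm `2`, and both terms on the right have norm `‖ξ - η‖ < 1`.
  have e5 : (sgn z' - sgn z) • U.symm Ω =
      (sgn z' • U.symm Ω - sgn z • η) - sgn z • (U.symm Ω - η) := by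
    rw [smul_sub, sub_smul]; abel
  have e6 := congrArg norm e5
  rw [norm_smul, U.symm.norm_map, hΩ, hz2.2.2] at e6
  have e7 := norm_sub_le (sgn z' • U.symm Ω - sgn z • η) (sgn z • (U.symm Ω - η))
  rw [e4, norm_smul, hz2.2.1, ← e6, one_mul] at e7
  change ‖U.symm Ω - η‖ < 1 at hlt
  linarith

/-! ### Loops -/

/-- The witness is the sum of the boundaries of the faces in `G`. A vertex belongs to it exactly
when it lies on an odd number of these faces, which determines where the product of checks is
supported. -/
theorem exists_product_of_checks (G : Finset Face) : ∃ a : Finset Vertex,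
    (∀ k ω e, HasSyndrome ω e → ω (op (!k) a) = sgn (pair (e k) G)) ∧
      ∀ v, pair a {v} = pair (bdry {v}) G := by
  induction G using Finset.induction_on with
  | empty => exact ⟨∅, fun k ω e h => by simp [h.map_one], fun v => by simp⟩
  | insert f G hf ih =>
    obtain ⟨a, ha, hv⟩ := ih
    refine ⟨symmDiff (bd f) a, fun k ω e h => ?_, fun v => ?_⟩
    · rw [insert_eq_symmDiff hf, ← op_mul, pair_symmDiff_right, sgn_add, ← ha k ω e h]
      exact h.map_chk_mul k f _
    · rw [insert_eq_symmDiff hf, pair_symmDiff_left, pair_symmDiff_right, hv, pair_bdry,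
        pair_comm (bd f)]

/-- Of the three differently colored faces at a vertex exactly two do not have color `c`. Hence
`charge` is insensitive to local operators, and a product of checks over the other two colors
cancels in the interior of a region. -/
theorem charge_bdry_singleton (v : Vertex) (c : Color) : charge (bdry {v}) c = 0 := by
  obtain ⟨x, y⟩ := v
  have key : ∀ f g h : Face, f.1.1 = x → g.1.1 = x - 1 → h.1.1 = x - 2 →
      (∀ f' : Face, (x, y) ∈ bd f' ↔ f' = f ∨ f' = g ∨ f' = h) → charge (bdry {(x, y)}) c = 0 := by
    intro f g h hf hg hh hb
    have hfg : f ≠ g := by rintro rfl; omega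
    have hfh : f ≠ h := by rintro rfl; omega
    have hgh : g ≠ h := by rintro rfl; omega
    have e : bdry {(x, y)} = {f, g, h} := by
      refine finset_ext_pair fun f' => ?_
      rw [pair_bdry, pair_singleton_left, pair_singleton_right]
      simp only [hb, Finset.mem_insert, Finset.mem_singleton]
    rw [e, charge, Finset.sum_insert (by simp [hfg, hfh]), Finset.sum_pair hgh]
    have : x % 3 = 0 ∨ x % 3 = 1 ∨ x % 3 = 2 := by omega
    rcases this with h3 | h3 | h3
    · have h4 : (x - 1) % 3 = 2 := by omega
      have h5 : (x - 2) % 3 = 1 := by omega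
      simp only [Face.color, hf, hg, hh, h3, h4, h5]
      cases c <;> decide
    · have h4 : (x - 1) % 3 = 0 := by omega
      have h5 : (x - 2) % 3 = 2 := by omega
      simp only [Face.color, hf, hg, hh, h3, h4, h5]
      cases c <;> decide
    · have h4 : (x - 1) % 3 = 1 := by omega
      have h5 : (x - 2) % 3 = 0 := by omega
      simp only [Face.color, hf, hg, hh, h3, h4, h5]
      cases c <;> decide
  rcases Int.even_or_odd (x + y) with h | h
  · rw [Int.even_iff] at h
    refine key ⟨(x, y - 1), ?_⟩ ⟨(x - 1, y), ?_⟩ ⟨(x - 2, y - 1), ?_⟩ rfl rfl rfl ?_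
    · rw [Int.odd_iff]; simp only; omega
    · rw [Int.odd_iff]; simp only; omega
    · rw [Int.odd_iff]; simp only; omega
    · rintro ⟨⟨p, q⟩, hp⟩
      rw [Int.odd_iff] at hp
      simp only [mem_bd, Subtype.mk.injEq, Prod.mk.injEq]
      simp only at hp
      omega
  · rw [Int.odd_iff] at h
    refine key ⟨(x, y), ?_⟩ ⟨(x - 1, y - 1), ?_⟩ ⟨(x - 2, y), ?_⟩ rfl rfl rfl ?_
    · rw [Int.odd_iff]; simp only; omega
    · rw [Int.odd_iff]; simp only; omega
    · rw [Int.odd_iff]; simp only; omega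
    · rintro ⟨⟨p, q⟩, hp⟩
      rw [Int.odd_iff] at hp
      simp only [mem_bd, Subtype.mk.injEq, Prod.mk.injEq]
      simp only at hp
      omega

theorem pair_filter_color {e G : Finset Face} (h : e ⊆ G) (c : Color) :
    pair e (G.filter fun f => f.color ≠ c) = charge e c := by
  rw [pair_comm, pair_eq_sum, charge]
  refine Finset.sum_congr rfl fun f hf => ?_
  by_cases hc : f.color = c <;> simp [hc, h hf]

/-- The product of the checks at all faces near `Λ` of colors other than `c` is a loop operator: it
cancels at every vertex all of whose faces are included. As `Λ` grows it escapes to infinity, while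
its value measures the charge `c`. -/
theorem HasSyndrome.not_gnsEquiv {ω ω' : PosFunctional} {e e' : Bool → Finset Face}
    (h : HasSyndrome ω e) (h' : HasSyndrome ω' e') {k : Bool} (hne : charge (e k) ≠ charge (e' k)) :
    ¬ GNSEquiv ω ω' := by
  obtain ⟨c, hc⟩ := Function.ne_iff.1 hne
  choose loop hloop hcomm using fun Λ : Finset Vertex =>
    exists_product_of_checks ((facesMeeting Λ).filter fun f => f.color ≠ c)
  have hev : ∀ s : Finset Face, ∀ᶠ Λ in (atTop : Filter (Finset Vertex)), s ⊆ facesMeeting Λ := by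
    intro s
    -- A face contains its own lower left corner, so it meets `Λ` once this point is in `Λ`.
    filter_upwards [eventually_ge_atTop (s.image Subtype.val)] with Λ hΛ f hf
    refine mem_facesMeeting_iff.2 ⟨f.1, ?_, hΛ (Finset.mem_image_of_mem _ hf)⟩
    rw [mem_bd]; omega
  refine not_gnsEquiv_of_sgn_ne (l := atTop) h.map_one h'.map_one (fun Λ => op (!k) (loop Λ))
    (fun Λ => op_star _ _) (fun Λ => op_mul_self _ _) (fun v M => ?_) (z := charge (e k) c)
    (z' := charge (e' k) c) ?_ ?_ hc
  · filter_upwards [hev (bdry {v})] with Λ hΛ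
    refine op_comm_site (fun hv => ?_) M
    have := hcomm Λ v
    rw [pair_filter_color hΛ, charge_bdry_singleton, pair_singleton_right, if_pos hv] at this
    exact one_ne_zero this
  · filter_upwards [hev (e k)] with Λ hΛ
    rw [hloop Λ k ω e h, pair_filter_color hΛ]
  · filter_upwards [hev (e' k)] with Λ hΛ
    rw [hloop Λ k ω' e' h', pair_filter_color hΛ]

/-! ### Excitations created by automorphisms -/

/-- The endomorphism `ρ` creates the excitations `d k` of type `k`. -/
def HasFlux (ρ : Obs →⋆ₐ[ℂ] Obs) (d : Bool → Finset Face) : Prop :=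
  ∀ k f, ρ (chk k f) = sgn (pair (d k) {f}) • chk k f

theorem HasFlux.pullback {ρ : Obs →⋆ₐ[ℂ] Obs} {d e : Bool → Finset Face} {ω : PosFunctional}
    (hρ : HasFlux ρ d) (hω : HasSyndrome ω e) :
    HasSyndrome (pullback ω ρ) fun k => symmDiff (d k) (e k) where
  map_one := by rw [pullback_apply, map_one, hω.map_one]
  map_chk k f := by
    rw [pullback_apply, hρ, map_smul, hω.map_chk, pair_symmDiff_left, sgn_add, smul_eq_mul]

theorem HasFlux.comp {ρ ρ' : Obs →⋆ₐ[ℂ] Obs} {d d' : Bool → Finset Face}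
    (hρ : HasFlux ρ d) (hρ' : HasFlux ρ' d') :
    HasFlux (ρ.comp ρ') fun k => symmDiff (d k) (d' k) := by
  intro k f
  rw [StarAlgHom.comp_apply, hρ', map_smul, hρ, smul_smul, pair_symmDiff_left, sgn_add, mul_comm]

/-- Whether a string of Pauli type `p` contains operators `σ^x` (`false`) or `σ^z` (`true`). -/
def Pauli.hasPart : Pauli → Bool → Bool
  | .x, k => !k
  | .y, _ => true
  | .z, k => k

theorem siteProd_sigmaX_eq_op {l : List Vertex} (hl : l.Nodup) :
    siteProd l sigmaX = op false l.toFinset := siteProd_eq_op hl false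

theorem siteProd_sigmaZ_eq_op {l : List Vertex} (hl : l.Nodup) :
    siteProd l sigmaZ = op true l.toFinset := siteProd_eq_op hl true

theorem op_mul_chk_mul_op_same (k : Bool) (f : Face) (a : Finset Vertex) :
    op k a * chk k f * op k a = sgn (pair (bdry a) {f}) • chk k f := by
  rw [mul_assoc, chk_mul_op_same, mul_smul_comm, ← mul_assoc, op_mul_self, one_mul]

theorem op_mul_chk_not_mul_op (k : Bool) (f : Face) (a : Finset Vertex) :
    op k a * chk (!k) f * op k a = chk (!k) f := by
  rw [mul_assoc, chk_not_mul_op, ← mul_assoc, op_mul_self, one_mul]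

theorem hasFlux_stringConj {l : List Vertex} (hl : l.Nodup) (p : Pauli) :
    HasFlux (stringConj l p) fun k => if p.hasPart k then bdry l.toFinset else ∅ := by
  intro k f
  rw [stringConj_apply]
  have h1 := op_mul_chk_mul_op_same k f l.toFinset
  have h2 := op_mul_chk_not_mul_op (!k) f l.toFinset
  cases p <;> simp only [stringOp, siteProd_sigmaX_eq_op hl, siteProd_sigmaZ_eq_op hl, star_mul,
    op_star]
  · cases k
    · simpa [Pauli.hasPart] using h1
    · simpa [Pauli.hasPart] using h2
  · have e : ∀ x z c : Obs, z * x * c * (x * z) = z * (x * c * x) * z := by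
      intros; simp only [mul_assoc]
    rw [e]
    cases k
    · rw [h1, mul_smul_comm, smul_mul_assoc]
      rw [Bool.not_not] at h2
      simp only [Bool.not_false] at h2
      simp [Pauli.hasPart, h2]
    · simp only [Bool.not_true, Bool.not_false] at h2
      rw [h2, h1]
      simp [Pauli.hasPart]
  · cases k
    · simpa [Pauli.hasPart] using h2
    · simpa [Pauli.hasPart] using h1

/-- Conjugation by a finite string multiplies each check by a sign, and for a fixed face this sign
is eventually constant, whatever happens at the receding end. -/
theorem hasFlux_of_tendsto {ρ : Obs →⋆ₐ[ℂ] Obs} {l : ℕ → List Vertex} (hl : ∀ n, (l n).Nodup)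
    {p : Pauli} (hρ : ∀ A, Tendsto (fun n => stringConj (l n) p A) atTop (𝓝 (ρ A)))
    {d : Finset Face} (hd : ∀ f, ∀ᶠ n in atTop, pair (bdry (l n).toFinset) {f} = pair d {f}) :
    HasFlux ρ fun k => if p.hasPart k then d else ∅ := by
  intro k f
  refine tendsto_nhds_unique (hρ (chk k f)) (tendsto_const_nhds.congr' ?_)
  filter_upwards [hd f] with n hn
  rw [hasFlux_stringConj (hl n)]
  by_cases hp : p.hasPart k = true <;> simp [hp, hn]

/-- The syndromes differ by boundaries of finite sets `a` and `b`. Conjugation by the local unitary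
`Z(b) X(a)` turns the first syndrome into the second, and by uniqueness it turns `ω` into `ω'`. -/
theorem HasSyndrome.gnsEquiv {ω ω' : PosFunctional} {e e' : Bool → Finset Face}
    (h : HasSyndrome ω e) (h' : HasSyndrome ω' e') (hc : ∀ k, charge (e k) = charge (e' k)) :
    GNSEquiv ω' ω := by
  obtain ⟨a, ha⟩ := homologous_of_charge_eq (hc false)
  obtain ⟨b, hb⟩ := homologous_of_charge_eq (hc true)
  let ρ := (stringConj a.toList .x).comp (stringConj b.toList .z)
  have hρ := (hasFlux_stringConj a.nodup_toList .x).comp (hasFlux_stringConj b.nodup_toList .z)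
  have he : ω' = ColorCode.pullback ω ρ := by
    refine h'.unique (e := e') ?_
    convert hρ.pullback h using 2 with k
    cases k
    · simp [Pauli.hasPart, ha, ← Finset.bot_eq_empty, symmDiff_comm (e false)]
    · simp [Pauli.hasPart, hb, ← Finset.bot_eq_empty, symmDiff_comm (e true)]
  refine gnsEquiv_conj (u := stringOp b.toList .z * stringOp a.toList .x)
    (mul_mem (stringOp_mem_unitary _ _) (stringOp_mem_unitary _ _)) fun A => ?_
  rw [he, pullback_apply, StarAlgHom.comp_apply, stringConj_apply, stringConj_apply, star_mul]
  simp only [mul_assoc]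

/-! ### The half-infinite strings -/

theorem HalfString.vertices_succ {c : Color} (γ : HalfString c) (n : ℕ) :
    γ.vertices (n + 1) = γ.vertices n ++ [γ.src n, γ.tgt n] := by
  simp [HalfString.vertices, List.range_succ]

theorem HalfString.mem_vertices {c : Color} (γ : HalfString c) {n : ℕ} {v : Vertex} :
    v ∈ γ.vertices n ↔ ∃ i < n, v = γ.src i ∨ v = γ.tgt i := by
  simp [HalfString.vertices]

theorem HalfString.nodup_vertices {c : Color} (γ : HalfString c) (n : ℕ) :
    (γ.vertices n).Nodup := by
  induction n with
  | zero => simp [HalfString.vertices]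
  | succ n ih =>
    rw [γ.vertices_succ, List.nodup_append]
    refine ⟨ih, by simpa using γ.src_ne_tgt n n, ?_⟩
    intro v hv w hw hvw
    subst hvw
    obtain ⟨i, hi, h⟩ := γ.mem_vertices.1 hv
    simp only [List.mem_cons, List.not_mem_nil, or_false] at hw
    rcases h with rfl | rfl <;> rcases hw with h | h
    · exact hi.ne (γ.src_injective h)
    · exact γ.src_ne_tgt _ _ h
    · exact γ.src_ne_tgt _ _ h.symm
    · exact hi.ne (γ.tgt_injective h)

/-- The boundaries of the edges telescope. The absence of repeated vertices makes the union of the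
edges a symmetric difference. -/
theorem HalfString.bdry_vertices {c : Color} (γ : HalfString c) (n : ℕ) :
    bdry (γ.vertices n).toFinset = symmDiff {γ.face 0} {γ.face n} := by
  induction n with
  | zero => simp [HalfString.vertices]
  | succ n ih =>
    have hd := γ.nodup_vertices (n + 1)
    rw [γ.vertices_succ] at hd ⊢
    have hdis : Disjoint (γ.vertices n).toFinset ({γ.src n, γ.tgt n} : Finset Vertex) := by
      rw [Finset.disjoint_left]
      intro v hv hv'
      exact (List.nodup_append.1 hd).2.2 v (by simpa using hv) v (by simpa using hv') rfl
    have e : (γ.vertices n ++ [γ.src n, γ.tgt n]).toFinset =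
        symmDiff (γ.vertices n).toFinset {γ.src n, γ.tgt n} := by
      rw [hdis.symmDiff_eq_sup, List.toFinset_append]
      simp
    rw [e, bdry_symmDiff, ih, bdry_edge (γ.adj n) (List.mem_toFinset.2 (γ.src_mem n))
      (List.mem_toFinset.2 (γ.tgt_mem n)) ((γ.color_face n).trans (γ.color_face _).symm)
      (γ.face_ne n), symmDiff_assoc, symmDiff_symmDiff_cancel_left]

/-- The faces of a string may repeat, but a face has only six vertices and the sources are distinct,
so each face is visited finitely often. -/
theorem HalfString.eventually_face_ne {c : Color} (γ : HalfString c) (f : Face) :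
    ∀ᶠ n in atTop, γ.face n ≠ f := by
  have h : ∀ᶠ n in atTop, γ.src n ∉ bd f := by
    have := γ.src_injective.tendsto_cofinite.eventually (bd f).finite_toSet.compl_mem_cofinite
    rwa [Nat.cofinite_eq_atTop] at this
  filter_upwards [h] with n hn hf
  exact hn (hf ▸ List.mem_toFinset.2 (γ.src_mem n))

theorem HalfString.hasFlux_rho {c : Color} (γ : HalfString c) (p : Pauli) :
    HasFlux (γ.rho p) fun k => if p.hasPart k then {γ.face 0} else ∅ := by
  refine hasFlux_of_tendsto γ.nodup_vertices (γ.tendsto_rhoFun p) fun f => ?_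
  filter_upwards [γ.eventually_face_ne f] with n hn
  rw [γ.bdry_vertices, pair_symmDiff_left, pair_singleton_left {f} (γ.face n),
    if_neg (by simpa using hn), add_zero]

/-! ### Limits of inner automorphisms -/

/-- A pointwise limit of `*`-homomorphisms of the quasi-local algebra. -/
theorem exists_lim_starAlgHom (φ : ℕ → Obs →⋆ₐ[ℂ] Obs)
    (h : ∀ v M, ∃ b, Tendsto (fun n => φ n (site v M)) atTop (𝓝 b)) :
    ∃ ρ : Obs →⋆ₐ[ℂ] Obs, ∀ A, Tendsto (fun n => φ n A) atTop (𝓝 (ρ A)) := by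
  choose ρ hρ using exists_lim_of_site φ h
  exact ⟨{
    toFun := ρ
    map_one' := tendsto_nhds_unique (hρ 1) (by simpa only [map_one] using tendsto_const_nhds)
    map_mul' := fun a b => tendsto_nhds_unique (hρ (a * b)) (by
      simpa only [map_mul] using (hρ a).mul (hρ b))
    map_zero' := tendsto_nhds_unique (hρ 0) (by simpa only [map_zero] using tendsto_const_nhds)
    map_add' := fun a b => tendsto_nhds_unique (hρ (a + b)) (by
      simpa only [map_add] using (hρ a).add (hρ b))
    commutes' := fun r => tendsto_nhds_unique (hρ (algebraMap ℂ Obs r)) (by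
      simpa only [AlgHomClass.commutes] using tendsto_const_nhds)
    map_star' := fun a => tendsto_nhds_unique (hρ (star a)) (by
      simpa only [map_star] using (hρ a).star) }, hρ⟩

/-- A limit of automorphisms need not be surjective; involutions are preserved because the `φ n` are
contractions. This supplies the bijectivity needed in `equivOn_pullback`. -/
theorem lim_involutive {φ : ℕ → Obs →⋆ₐ[ℂ] Obs} {ρ : Obs →⋆ₐ[ℂ] Obs}
    (hρ : ∀ A, Tendsto (fun n => φ n A) atTop (𝓝 (ρ A))) (hφ : ∀ n A, φ n (φ n A) = A) :
    Function.Involutive ρ := by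
  intro A
  refine tendsto_nhds_unique (hρ (ρ A)) (tendsto_iff_norm_sub_tendsto_zero.2 ?_)
  refine squeeze_zero (fun n => norm_nonneg _) (fun n => ?_)
    (tendsto_iff_norm_sub_tendsto_zero.1 (hρ A))
  calc ‖φ n (ρ A) - A‖ = ‖φ n (ρ A - φ n A)‖ := by rw [map_sub, hφ]
    _ ≤ ‖ρ A - φ n A‖ := NonUnitalStarAlgHom.norm_apply_le (φ n) _
    _ = _ := norm_sub_rev _ _

theorem starAlgHom_eq_self_of_site {ρ : Obs →⋆ₐ[ℂ] Obs} {Λ : Set Vertex}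
    (h : ∀ v ∈ Λ, ∀ M, ρ (site v M) = site v M) {A : Obs} (hA : A ∈ localAlg Λ) : ρ A = A := by
  have hc : Continuous ρ := map_continuous ρ
  have : localAlg Λ ≤ StarAlgHom.equalizer ρ (StarAlgHom.id ℂ Obs) := by
    refine StarSubalgebra.topologicalClosure_minimal (StarAlgebra.adjoin_le ?_)
      (isClosed_eq hc continuous_id)
    rintro _ ⟨v, hv, M, rfl⟩
    exact h v hv M
  exact this hA

/-- The Pauli type of the operators `σ^x` (`false`) and `σ^z` (`true`). -/
def Pauli.ofBool : Bool → Pauli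
  | false => .x
  | true => .z

theorem Pauli.hasPart_ofBool (k k' : Bool) : (Pauli.ofBool k).hasPart k' = (k' == k) := by
  cases k <;> cases k' <;> rfl

theorem stringConj_toList (k : Bool) (a : Finset Vertex) (A : Obs) :
    stringConj a.toList (Pauli.ofBool k) A = op k a * A * op k a := by
  have h : stringOp a.toList (Pauli.ofBool k) = op k a := by cases k <;> rfl
  rw [stringConj_apply, h, op_star]

theorem op_conj_site_of_notMem {k : Bool} {a : Finset Vertex} {v : Vertex} (h : v ∉ a) (M) :
    op k a * site v M * op k a = site v M := by
  rw [op_comm_site h, mul_assoc, op_mul_self, mul_one]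

theorem op_conj_site_of_mem {k : Bool} {a : Finset Vertex} {v : Vertex} (h : v ∈ a) (M) :
    op k a * site v M * op k a = op k {v} * site v M * op k {v} := by
  have e : a = symmDiff {v} (a.erase v) := by
    rw [← insert_eq_symmDiff (Finset.notMem_erase v a), Finset.insert_erase h]
  have h2 := op_conj_site_of_notMem (k := k) (Finset.notMem_erase v a) M
  have h3 : op k a = op k {v} * op k (a.erase v) := by rw [op_mul, ← e]
  calc op k a * site v M * op k a
      = op k {v} * (op k (a.erase v) * site v M * op k (a.erase v)) * op k {v} := by
        rw [h3]
        nth_rewrite 2 [op_commute]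
        simp only [mul_assoc]
    _ = _ := by rw [h2]

/-- Conjugation by `op k (a n)` affects a one-qubit observable only through membership of its vertex
in `a n`, so stabilization at every vertex gives the limit. Each conjugation is an involution that
fixes the observables outside `W`. -/
theorem exists_hasFlux_of_seq (k : Bool) {a : ℕ → Finset Vertex} {W : Set Vertex}
    (hW : ∀ n, (a n : Set Vertex) ⊆ W) (ha : ∀ v, ∃ P : Prop, ∀ᶠ n in atTop, (v ∈ a n ↔ P))
    {d : Finset Face} (hd : ∀ f, ∀ᶠ n in atTop, pair (bdry (a n)) {f} = pair d {f}) :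
    ∃ ρ : Obs →⋆ₐ[ℂ] Obs, HasFlux ρ (fun k' => if k' = k then d else ∅) ∧
      Function.Bijective ρ ∧ ∀ A ∈ localAlg Wᶜ, ρ A = A := by
  obtain ⟨ρ, hρ⟩ := exists_lim_starAlgHom (fun n => stringConj (a n).toList (Pauli.ofBool k)) (by
    intro v M
    obtain ⟨P, hP⟩ := ha v
    by_cases hp : P
    · refine ⟨op k {v} * site v M * op k {v}, tendsto_const_nhds.congr' ?_⟩
      filter_upwards [hP] with n hn
      rw [stringConj_toList, op_conj_site_of_mem (hn.2 hp)]
    · refine ⟨site v M, tendsto_const_nhds.congr' ?_⟩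
      filter_upwards [hP] with n hn
      rw [stringConj_toList, op_conj_site_of_notMem (fun h => hp (hn.1 h))])
  refine ⟨ρ, ?_, (lim_involutive hρ fun n A => ?_).bijective, fun A hA =>
    starAlgHom_eq_self_of_site (fun v hv M => ?_) hA⟩
  · have := hasFlux_of_tendsto (fun n => (a n).nodup_toList) hρ (d := d)
      (by simpa only [Finset.toList_toFinset] using hd)
    simpa only [Pauli.hasPart_ofBool, beq_iff_eq] using this
  · simp only [stringConj_toList]
    calc _ = op k (a n) * op k (a n) * A * (op k (a n) * op k (a n)) := by simp only [mul_assoc]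
      _ = A := by rw [op_mul_self, one_mul, mul_one]
  · refine tendsto_nhds_unique (hρ _) (tendsto_const_nhds.congr fun n => ?_)
    rw [stringConj_toList, op_conj_site_of_notMem fun h => hv (hW n h)]

/-! ### Strings in cones -/

theorem position_add_smul (v t : Vertex) (n : ℕ) :
    position (v + n • t) = position v + (n : ℝ) • position t := by
  ext i
  fin_cases i <;> simp [position]

/-- Since `cos θ < 1`, the axis lies in the open set of cone directions, so some rational direction
does too, and the set is invariant under positive scaling. The factor `6` makes the translation
preserve both the lattice (even) and the coloring (divisible by three). -/
theorem exists_direction {a : EuclideanSpace ℝ (Fin 2)} {θ : ℝ} (ha : ‖a‖ = 1) (h0 : 0 < θ)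
    (hπ : θ < Real.pi) : ∃ i j : ℤ, ‖position (6 * i, 6 * j)‖ * Real.cos θ <
      inner ℝ (position (6 * i, 6 * j)) a := by
  let emb : ℝ × ℝ → EuclideanSpace ℝ (Fin 2) := fun x => !₂[x.1, x.2]
  have hemb : Continuous emb := by
    refine (PiLp.continuous_toLp 2 _).comp (continuous_pi fun i => ?_)
    fin_cases i
    exacts [continuous_fst, continuous_snd]
  have hopen : IsOpen {x : ℝ × ℝ | ‖emb x‖ * Real.cos θ < inner ℝ (emb x) a} :=
    isOpen_lt (by fun_prop) (by fun_prop)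
  have hcos : Real.cos θ < 1 := by
    rw [← Real.cos_zero]
    exact Real.cos_lt_cos_of_nonneg_of_le_pi le_rfl hπ.le h0
  have hne : (a 0, a 1) ∈ {x : ℝ × ℝ | ‖emb x‖ * Real.cos θ < inner ℝ (emb x) a} := by
    have : emb (a 0, a 1) = a := by
      ext i
      fin_cases i <;> rfl
    rw [Set.mem_ofPred_eq, this, ha, real_inner_self_eq_norm_sq, ha]
    simpa using hcos
  obtain ⟨⟨q, r⟩, hqr⟩ := (Rat.denseRange_cast (𝕜 := ℝ)).prodMap (Rat.denseRange_cast (𝕜 := ℝ))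
    |>.exists_mem_open hopen ⟨_, hne⟩
  refine ⟨q.num * r.den, r.num * q.den, ?_⟩
  have e : position (6 * (q.num * r.den), 6 * (r.num * q.den)) =
      (6 * q.den * r.den : ℝ) • emb ((q : ℝ), (r : ℝ)) := by
    have hq : (q : ℝ) * q.den = q.num := by exact_mod_cast Rat.mul_den_eq_num q
    have hr : (r : ℝ) * r.den = r.num := by exact_mod_cast Rat.mul_den_eq_num r
    ext i
    fin_cases i
    · simp [position, emb, ← hq]; ring
    · simp [position, emb, ← hr]; ring
  have hpos : (0 : ℝ) < 6 * q.den * r.den := by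
    have := q.pos
    have := r.pos
    positivity
  rw [e, norm_smul, Real.norm_of_nonneg hpos.le, real_inner_smul_left, mul_assoc]
  exact mul_lt_mul_of_pos_left hqr hpos

/-- Seen from the apex and divided by `n`, the point tends to `t`; the cone of directions is open
and invariant under scaling. -/
theorem eventually_mem_cone {p a : EuclideanSpace ℝ (Fin 2)} {θ : ℝ} {t : Vertex}
    (ht : ‖position t‖ * Real.cos θ < inner ℝ (position t) a) (v : Vertex) :
    ∀ᶠ n : ℕ in atTop, v + n • t ∈ cone p a θ := by
  have hlim : Tendsto (fun n : ℕ => (n : ℝ)⁻¹ • (position v - p) + position t) atTop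
      (𝓝 (position t)) := by
    have := (tendsto_inv_atTop_nhds_zero_nat (𝕜 := ℝ)).smul_const (position v - p)
    simpa using this.add_const (position t)
  have hopen : IsOpen {x : EuclideanSpace ℝ (Fin 2) | ‖x‖ * Real.cos θ < inner ℝ x a} :=
    isOpen_lt (by fun_prop) (by fun_prop)
  filter_upwards [hlim.eventually (hopen.mem_nhds ht), eventually_gt_atTop 0] with n hn hn0
  have hpos : (0 : ℝ) < n := by exact_mod_cast hn0
  have e : position (v + n • t) - p =
      (n : ℝ) • ((n : ℝ)⁻¹ • (position v - p) + position t) := by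
    rw [smul_add, smul_smul, mul_inv_cancel₀ hpos.ne', one_smul, position_add_smul]
    abel
  rw [cone, Set.mem_ofPred_eq, e, norm_smul, Real.norm_of_nonneg hpos.le, real_inner_smul_left,
    mul_assoc]
  exact mul_lt_mul_of_pos_left hn hpos

theorem pair_image {α : Type*} [DecidableEq α] {φ : α → α} (hφ : Function.Injective φ)
    (a b : Finset α) : pair (a.image φ) (b.image φ) = pair a b := by
  rw [pair, ← Finset.image_inter _ _ hφ, Finset.card_image_of_injective _ hφ, pair]

theorem bdry_image_add {P : Finset Vertex} {f g : Face} (hP : bdry P = symmDiff {f} {g})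
    (s : ℤ × ℤ) (hs : Even (s.1 + s.2)) :
    bdry (P.image (· + s)) = symmDiff {f.shift s hs} {g.shift s hs} := by
  refine finset_ext_pair fun h => ?_
  have hs' : Even ((-s).1 + (-s).2) := by
    rw [Int.even_iff] at *
    simp only [Prod.fst_neg, Prod.snd_neg]
    omega
  have e : h = (h.shift (-s) hs').shift s hs := Subtype.ext (by simp [Face.shift])
  have hmem : ∀ f : Face, h.shift (-s) hs' = f ↔ h = f.shift s hs := fun f => by
    rw [Subtype.ext_iff, Subtype.ext_iff]
    exact add_neg_eq_iff_eq_add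
  rw [pair_bdry, e, bd_shift, pair_image (add_left_injective s), ← pair_bdry, hP, ← e,
    pair_symmDiff_left, pair_symmDiff_left]
  simp only [pair_singleton_right, Finset.mem_singleton, hmem]

/-- An excitation of any color and type can be created by an automorphism localized in a cone. -/
theorem exists_hasFlux_singleton {p a : EuclideanSpace ℝ (Fin 2)} {θ : ℝ} (ha : ‖a‖ = 1)
    (h0 : 0 < θ) (hπ : θ < Real.pi) (k : Bool) (c : Color) :
    ∃ f : Face, f.color = c ∧ ∃ ρ : Obs →⋆ₐ[ℂ] Obs,
      HasFlux ρ (fun k' => if k' = k then {f} else ∅) ∧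
        Function.Bijective ρ ∧ ∀ A ∈ localAlg (cone p a θ)ᶜ, ρ A = A := by
  obtain ⟨i, j, hij⟩ := exists_direction ha h0 hπ
  let t : Vertex := (6 * i, 6 * j)
  have ht0 : t ≠ 0 := by
    intro h
    have : position (6 * i, 6 * j) = 0 := by
      change position t = 0
      rw [h]
      ext i
      fin_cases i <;> simp [position]
    simp [this] at hij
  have ht : ∀ n : ℕ, Even ((n • t).1 + (n • t).2) := fun n => by
    rw [Int.even_iff]
    simp only [t, Prod.smul_mk]
    rw [nsmul_eq_mul, nsmul_eq_mul, show (n : ℤ) * (6 * i) + n * (6 * j) =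
      2 * (n * (3 * i) + n * (3 * j)) by ring]
    exact Int.mul_emod_right _ _
  obtain ⟨f₀, hf₀⟩ : ∃ f : Face, f.color = c := by
    cases c
    exacts [⟨⟨(0, 1), by decide⟩, by decide⟩, ⟨⟨(1, 0), by decide⟩, by decide⟩,
      ⟨⟨(2, 1), by decide⟩, by decide⟩]
  let F (n : ℕ) : Face := f₀.shift (n • t) (ht n)
  have hF : ∀ n, (F n).1 = f₀.1 + n • t := fun n => rfl
  have hFc : ∀ n, (F n).color = c := fun n => by
    rw [← hf₀, color_eq_iff, hF]
    simp only [t, Prod.smul_mk, Prod.fst_add]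
    rw [nsmul_eq_mul, show (n : ℤ) * (6 * i) = 3 * (n * (2 * i)) by ring]
    omega
  have hF0 : F 0 = f₀ := Subtype.ext (by simp [hF])
  -- `P` joins a face to its translate by `t`. From the translate number `N` on, all copies of `P`
  -- lie in the cone, and they chain up to a periodic string to infinity.
  obtain ⟨P, hP⟩ := homologous_of_color_eq ((hFc 0).trans (hFc 1).symm)
  obtain ⟨N, hN⟩ := eventually_atTop.1
    ((P.eventually_all (l := atTop) (p := fun v n => v + n • t ∈ cone p a θ)).2
      fun v _ => eventually_mem_cone hij v)
  let s (n : ℕ) : Finset Vertex := P.image (· + (N + n) • t)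
  have hs : ∀ n, bdry (s n) = symmDiff {F (N + n)} {F (N + n + 1)} := fun n => by
    rw [bdry_image_add hP _ (ht _)]
    congr 2 <;> refine Subtype.ext ?_ <;> simp only [Face.shift, F] <;> module
  have hinj : Function.Injective fun n : ℕ => (N + n) • t := fun m n h => by
    have := smul_left_injective ℤ ht0 (show ((N + m : ℕ) : ℤ) • t = ((N + n : ℕ) : ℤ) • t by
      simpa only [natCast_zsmul] using h)
    omega
  have hfin : ∀ S : Set Vertex, S.Finite → ∀ᶠ n : ℕ in atTop, (N + n) • t ∉ S := fun S hS => by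
    have := hinj.tendsto_cofinite.eventually hS.compl_mem_cofinite
    rwa [Nat.cofinite_eq_atTop] at this
  have hsv : ∀ v, ∀ᶠ n in atTop, v ∉ s n := fun v => by
    filter_upwards [hfin _ (P.image (v - ·)).finite_toSet] with n hn hv
    obtain ⟨w, hw, rfl⟩ := Finset.mem_image.1 hv
    exact hn (Finset.mem_coe.2 (Finset.mem_image.2 ⟨w, hw, by simp⟩))
  have hFf : ∀ f, ∀ᶠ n in atTop, F (N + n) ≠ f := fun f => by
    filter_upwards [hfin _ (Set.finite_singleton (f.1 - f₀.1))] with n hn hf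
    exact hn (by rw [← hf, hF]; simp)
  -- Symmetric differences, since consecutive copies of `P` may overlap; their boundaries still
  -- telescope.
  let b : ℕ → Finset Vertex := fun n => Nat.rec ∅ (fun m x => symmDiff x (s m)) n
  have hb : ∀ n, b (n + 1) = symmDiff (b n) (s n) := fun n => rfl
  have hbb : ∀ n, bdry (b n) = symmDiff {F N} {F (N + n)} := fun n => by
    induction n with
    | zero => simp [b]
    | succ n ih => rw [hb, bdry_symmDiff, ih, hs, symmDiff_assoc, symmDiff_symmDiff_cancel_left,
        add_assoc]
  refine ⟨F N, hFc N, exists_hasFlux_of_seq k (a := b) (fun n => ?_) (fun v => ?_) fun f => ?_⟩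
  · induction n with
    | zero => simp [b]
    | succ n ih =>
      intro v hv
      rw [Finset.mem_coe, hb, Finset.mem_symmDiff] at hv
      rcases hv with hv | hv
      · exact ih hv.1
      · obtain ⟨w, hw, rfl⟩ := Finset.mem_image.1 hv.1
        exact hN _ (Nat.le_add_right N n) w hw
  · obtain ⟨n₀, hn₀⟩ := eventually_atTop.1 (hsv v)
    refine ⟨v ∈ b n₀, eventually_atTop.2 ⟨n₀, fun n hn => ?_⟩⟩
    induction n, hn using Nat.le_induction with
    | base => rfl
    | succ n hn ih =>
      rw [← ih, hb, Finset.mem_symmDiff]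
      simp [hn₀ n hn]
  · filter_upwards [hFf f] with n hn
    rw [hbb, pair_symmDiff_left, pair_singleton_left {f} (F (N + n)),
      if_neg (by simpa using hn), add_zero]

/-- Each face of `e` is replaced by a face of the same color in which a string inside the cone ends.
Only the charge is retained, which is all that the sector depends on. -/
theorem exists_hasFlux_of_charge {p a : EuclideanSpace ℝ (Fin 2)} {θ : ℝ} (ha : ‖a‖ = 1)
    (h0 : 0 < θ) (hπ : θ < Real.pi) (e : Bool → Finset Face) :
    ∃ d : Bool → Finset Face, (∀ k, charge (d k) = charge (e k)) ∧ ∃ ρ : Obs →⋆ₐ[ℂ] Obs,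
      HasFlux ρ d ∧ Function.Bijective ρ ∧ ∀ A ∈ localAlg (cone p a θ)ᶜ, ρ A = A := by
  have key : ∀ k : Bool, ∀ s : Finset Face, ∃ d : Finset Face, charge d = charge s ∧
      ∃ ρ : Obs →⋆ₐ[ℂ] Obs, HasFlux ρ (fun k' => if k' = k then d else ∅) ∧
        Function.Bijective ρ ∧ ∀ A ∈ localAlg (cone p a θ)ᶜ, ρ A = A := by
    intro k s
    induction s using Finset.induction_on with
    | empty =>
      exact ⟨∅, rfl, StarAlgHom.id ℂ Obs, fun k' f => by simp, Function.bijective_id,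
        fun A _ => rfl⟩
    | insert f s hf ih =>
      obtain ⟨d, hd, ρ, hρ, hρb, hρl⟩ := ih
      obtain ⟨g, hg, ρ', hρ', hρb', hρl'⟩ := exists_hasFlux_singleton (p := p) ha h0 hπ k f.color
      refine ⟨symmDiff {g} d, ?_, ρ'.comp ρ, ?_, hρb'.comp hρb, fun A hA => ?_⟩
      · rw [insert_eq_symmDiff hf, charge_symmDiff, charge_symmDiff, hd]
        congr 1
        ext c
        rw [charge_singleton, charge_singleton, hg]
      · have := hρ'.comp hρ
        intro k' f'
        rw [this k' f']
        by_cases hk : k' = k <;> simp [hk]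
      · rw [StarAlgHom.comp_apply, hρl A hA, hρl' A hA]
  obtain ⟨d, hd, ρ, hρ, hρb, hρl⟩ := key false (e false)
  obtain ⟨d', hd', ρ', hρ', hρb', hρl'⟩ := key true (e true)
  refine ⟨_, fun k => ?_, ρ.comp ρ', hρ.comp hρ', hρb.comp hρb', fun A hA => ?_⟩
  · cases k
    · simpa [← Finset.bot_eq_empty] using hd
    · simpa [← Finset.bot_eq_empty] using hd'
  · rw [StarAlgHom.comp_apply, hρl' A hA, hρl A hA]

/-- The state is globally equivalent to `ω₀ ∘ ρ` with `ρ` of the same charge localized in the cone,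
and outside the cone `ρ` acts trivially. -/
theorem HasSyndrome.isSuperselectionSector {ω₀ ω : PosFunctional} {e : Bool → Finset Face}
    (h₀ : HasSyndrome ω₀ fun _ => ∅) (h : HasSyndrome ω e) : IsSuperselectionSector ω₀ ω := by
  intro p a θ ha h0 hπ
  obtain ⟨d, hd, ρ, hρ, hρb, hρl⟩ := exists_hasFlux_of_charge (p := p) ha h0 hπ e
  have h1 := hρ.pullback h₀
  have h2 : GNSEquiv ω (ColorCode.pullback ω₀ ρ) := h1.gnsEquiv h fun k => by
    rw [← hd]; simp [← Finset.bot_eq_empty]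
  exact (h2.mono le_top).trans (equivOn_pullback ω₀ hρb hρl)

/-! ### Charges of the string types -/

instance : Fintype Color := ⟨{.r, .g, .b}, fun c => by cases c <;> decide⟩

instance : Fintype Pauli := ⟨{.x, .y, .z}, fun p => by cases p <;> decide⟩

/-- The charge of the excitation at the end of a string of color `c` and Pauli type `p`. -/
def endCharge (c : Color) (p : Pauli) (k : Bool) (c' : Color) : ZMod 2 :=
  if p.hasPart k && c != c' then 1 else 0

theorem charge_end {c : Color} (γ : HalfString c) (p : Pauli) (k : Bool) :
    charge (if p.hasPart k then {γ.face 0} else ∅) = endCharge c p k := by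
  ext c'
  by_cases h : p.hasPart k = true
  · rw [if_pos h, charge_singleton, γ.color_face]
    by_cases hc : c = c' <;> simp [endCharge, h, hc]
  · simp [h, endCharge]

theorem exists_hasSyndrome_stringState {ω₀ : PosFunctional} (h₀ : HasSyndrome ω₀ fun _ => ∅)
    (s : StringType) (γ : HalfString s.color) : ∃ e, HasSyndrome (stringState ω₀ s γ) e ∧
      ∀ k, charge (e k) = endCharge s.color s.pauli k :=
  ⟨_, (γ.hasFlux_rho s.pauli).pullback h₀, fun k => by
    rw [charge_symmDiff, charge_end, charge_empty, add_zero]⟩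

theorem exists_hasSyndrome_compositeState {ω₀ : PosFunctional} (h₀ : HasSyndrome ω₀ fun _ => ∅)
    (s t : StringType) (γ : HalfString s.color) (γ' : HalfString t.color) :
    ∃ e, HasSyndrome (compositeState ω₀ s t γ γ') e ∧
      ∀ k, charge (e k) = endCharge s.color s.pauli k + endCharge t.color t.pauli k :=
  ⟨_, ((γ.hasFlux_rho s.pauli).comp (γ'.hasFlux_rho t.pauli)).pullback h₀, fun k => by
    rw [charge_symmDiff, charge_symmDiff, charge_end, charge_end, charge_empty, add_zero]⟩

theorem exists_endCharge_add_ne_zero {c c' : Color} {p p' : Pauli} (hc : c ≠ c') (hp : p ≠ p') :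
    ∃ k, endCharge c p k + endCharge c' p' k ≠ 0 := by
  revert c c' p p'
  decide

/-- Two different colors, and likewise two different Pauli labels, are linearly independent over
`ZMod 2`, so the composite charge is a tensor of rank two, whereas a single string has a pure
tensor. The finitely many cases are checked by computation. -/
theorem exists_endCharge_add_ne {c c' : Color} {p p' : Pauli} (hc : c ≠ c') (hp : p ≠ p')
    (c'' : Color) (p'' : Pauli) :
    ∃ k, endCharge c p k + endCharge c' p' k ≠ endCharge c'' p'' k := by
  revert c c' p p' c'' p''
  decide

/-- The charge of the `i`-th fermion, computed from the `j`-th pair of strings. -/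
def fermionCharge (i : Fin 6) (j : Fin 3) (k : Bool) : Color → ZMod 2 :=
  endCharge (fermionPairs i j).1.color (fermionPairs i j).1.pauli k +
    endCharge (fermionPairs i j).2.color (fermionPairs i j).2.pauli k

theorem fermionCharge_eq (i : Fin 6) (j j' : Fin 3) (k : Bool) :
    fermionCharge i j k = fermionCharge i j' k := by
  revert i j j' k
  decide

theorem exists_fermionCharge_ne {i i' : Fin 6} (h : i ≠ i') (j j' : Fin 3) :
    ∃ k, fermionCharge i j k ≠ fermionCharge i' j' k := by
  revert i i' j j'
  decide

end ColorCode

end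

/-! ### The sectors of the color code -/

open ColorCode
theorem mainTheorem5 :
    ∃ ω₀ : PosFunctional,
      -- `ω₀` is the unique translation invariant ground state
      (IsInvariantGroundState ω₀ ∧ ∀ ω : PosFunctional, IsInvariantGroundState ω → ω = ω₀) ∧
      -- every composite is a superselection sector, inequivalent to `π₀` and to all `π^{ck}`
      (∀ s t : StringType, s.color ≠ t.color → s.pauli ≠ t.pauli →
        ∀ (γ : HalfString s.color) (γ' : HalfString t.color),
          IsSuperselectionSector ω₀ (compositeState ω₀ s t γ γ') ∧
          ¬ GNSEquiv (compositeState ω₀ s t γ γ') ω₀ ∧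
          ∀ (u : StringType) (γ'' : HalfString u.color),
            ¬ GNSEquiv (compositeState ω₀ s t γ γ') (stringState ω₀ u γ'')) ∧
      -- the three pairs of strings listed for a fermion give equivalent representations
      (∀ (i : Fin 6) (j j' : Fin 3)
        (γ₁ : HalfString (fermionPairs i j).1.color) (γ₂ : HalfString (fermionPairs i j).2.color)
        (δ₁ : HalfString (fermionPairs i j').1.color)
        (δ₂ : HalfString (fermionPairs i j').2.color),
          GNSEquiv
            (compositeState ω₀ (fermionPairs i j).1 (fermionPairs i j).2 γ₁ γ₂)
            (compositeState ω₀ (fermionPairs i j').1 (fermionPairs i j').2 δ₁ δ₂)) ∧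
      -- different fermions are inequivalent
      (∀ (i i' : Fin 6), i ≠ i' → ∀ (j j' : Fin 3)
        (γ₁ : HalfString (fermionPairs i j).1.color) (γ₂ : HalfString (fermionPairs i j).2.color)
        (δ₁ : HalfString (fermionPairs i' j').1.color)
        (δ₂ : HalfString (fermionPairs i' j').2.color),
          ¬ GNSEquiv
            (compositeState ω₀ (fermionPairs i j).1 (fermionPairs i j).2 γ₁ γ₂)
            (compositeState ω₀ (fermionPairs i' j').1 (fermionPairs i' j').2 δ₁ δ₂)) := by
  obtain ⟨ω₀, h₀⟩ := exists_hasSyndrome_empty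
  refine ⟨ω₀, ⟨h₀.isInvariantGroundState, fun ω hω => hω.hasSyndrome.unique h₀⟩, ?_, ?_, ?_⟩
  · intro s t hc hp γ γ'
    obtain ⟨e, he, hq⟩ := exists_hasSyndrome_compositeState h₀ s t γ γ'
    refine ⟨h₀.isSuperselectionSector he, ?_, fun u γ'' => ?_⟩
    · obtain ⟨k, hk⟩ := exists_endCharge_add_ne_zero hc hp
      exact he.not_gnsEquiv h₀ (k := k) (by rwa [hq, charge_empty])
    · obtain ⟨e', he', hq'⟩ := exists_hasSyndrome_stringState h₀ u γ''
      obtain ⟨k, hk⟩ := exists_endCharge_add_ne hc hp u.color u.pauli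
      exact he.not_gnsEquiv he' (k := k) (by rwa [hq, hq'])
  · intro i j j' γ₁ γ₂ δ₁ δ₂
    obtain ⟨e, he, hq⟩ := exists_hasSyndrome_compositeState h₀ _ _ γ₁ γ₂
    obtain ⟨e', he', hq'⟩ := exists_hasSyndrome_compositeState h₀ _ _ δ₁ δ₂
    refine he'.gnsEquiv he fun k => ?_
    rw [hq, hq']
    exact fermionCharge_eq i j' j k
  · intro i i' hii j j' γ₁ γ₂ δ₁ δ₂
    obtain ⟨e, he, hq⟩ := exists_hasSyndrome_compositeState h₀ _ _ γ₁ γ₂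
    obtain ⟨e', he', hq'⟩ := exists_hasSyndrome_compositeState h₀ _ _ δ₁ δ₂
    obtain ⟨k, hk⟩ := exists_fermionCharge_ne hii j j'
    refine he.not_gnsEquiv he' (k := k) ?_
    rwa [hq, hq']
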